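/- Let $n\ge 1$ and let $(M,\phi,\xi,\eta,g)$ be a smooth $(2n+1)$-dimensional Sasakian manifold: $(\phi,\xi,\eta,g)$ is an almost contact metric structure ($\phi^2=-\mathrm{id}+\eta\otimes\xi$, $\eta(\xi)=1$, $\eta\circ\phi=0$, $\phi\xi=0$, $g(\phi X,\phi Y)=g(X,Y)-\eta(X)\eta(Y)$, $g(X,\phi Y)=-g(\phi X,Y)$, $g(X,\xi)=\eta(X)$) that is contact metric, $d\eta(X,Y)=g(X,\phi Y)$ with $d\eta(X,Y)=\frac12\big(X\eta(Y)-Y\eta(X)-\eta([X,Y])\big)$, and normal, $2\,d\eta(X,Y)\,\xi+[\phi,\phi](X,Y)=0$, where $[\phi,\phi]$ is the Nijenhuis tensor of $\phi$. Let $R(X,Y)Z=\nabla_X\nabla_YZ-\nabla_Y\nabla_XZ-\nabla_{[X,Y]}Z$ be the curvature tensor of the Levi-Civita connection $\nabla$ of $g$, $S(Y,Z)=\operatorname{tr}\big(X\mapsto R(X,Y)Z\big)$ the Ricci tensor, $r=\operatorname{tr}_g S$ the scalar curvature, and $S^*(X,Y)=\frac12\operatorname{tr}\big(\phi\circ R(X,\phi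 Y)\big)$ the $*$-Ricci tensor. Suppose that $M$ admits a $*$-conformal $\eta$-Ricci soliton, that is, there are constants $\lambda,\mu\in\mathbb R$ and a function $p:M\to\mathbb R$ with $$\pounds_\xi g+2S^*+\Big[2\lambda-\Big(p+\frac{2}{2n+1}\Big)\Big]g+2\mu\,\eta\otimes\eta=0 .$$ Let $a,b\neq0$ be real constants, let $$\overline P(X,Y)Z=aR(X,Y)Z+b\,[S(Y,Z)X-S(X,Z)Y]-\frac{r}{2n+1}\Big(\frac{a}{2n}+b\Big)[g(Y,Z)X-g(X,Z)Y]$$ be the pseudo-projective curvature tensor, and suppose that $\overline P(\xi,X)\cdot S=0$, i.e. $S(\overline P(\xi,X)Y,Z)+S(Y,\overline P(\xi,X)Z)=0$ for all $X,Y,Z$. Then: 1. either $\mu=1$ and $\lambda=\frac12\big(p+\frac{2}{2n+1}\big)-1$ on $M$, or $a-\frac{r}{2n+1}\big(\frac{a}{2n}+b\big)=0$ on $M$; 2. if moreover the scalar curvature constraint $r=-1$ holds on $M$, then either $\mu=1$ and $\lambda=\frac12\big(p+\frac{2}{2n+1}\big)-1$ on $M$, or $[2n(2n+1)+1]a+2nb=0$.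 -/

import Mathlib

open Bundle FiberBundle
open scoped Manifold ContDiff

noncomputable section

namespace SasakiGeom

variable {E : Type*} [NormedAddCommGroup E] [NormedSpace ℝ E]
  {H : Type*} [TopologicalSpace H] {I : ModelWithCorners ℝ E H}
  {M : Type*} [TopologicalSpace M] [ChartedSpace H M] [IsManifold I ∞ M]

theorem mdifferentiableAt_extend_tangent {x : M} (v : TangentSpace I x) :
    MDiffAt (T% (extend E v : Π y : M, TangentSpace I y)) x :=
  mdifferentiableAt_extend (V := fun x : M ↦ TangentSpace I x) ..

variable [RiemannianBundle (fun x : M ↦ TangentSpace I x)]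

/-! ### The Levi-Civita connection, through the Koszul formula

The metric `g(u, v)` on the tangent space at `x` is `inner ℝ u v`. -/

/-- The right-hand side of the Koszul formula, that is `2 g(∇_X Y, Z)`:
`X g(Y,Z) + Y g(Z,X) - Z g(X,Y) - g(X,[Y,Z]) - g(Y,[X,Z]) + g(Z,[X,Y])`. -/
def koszul (X Y Z : Π x : M, TangentSpace I x) (x : M) : ℝ :=
  mvfderiv I (fun y ↦ (inner ℝ (Y y) (Z y) : ℝ)) x (X x)
    + mvfderiv I (fun y ↦ (inner ℝ (Z y) (X y) : ℝ)) x (Y x)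
    - mvfderiv I (fun y ↦ (inner ℝ (X y) (Y y) : ℝ)) x (Z x)
    - inner ℝ (X x) (VectorField.mlieBracket I Y Z x)
    - inner ℝ (Y x) (VectorField.mlieBracket I X Z x)
    + inner ℝ (Z x) (VectorField.mlieBracket I X Y x)

theorem inner_comm_fun (X Y : Π x : M, TangentSpace I x) :
    (fun y ↦ (inner ℝ (X y) (Y y) : ℝ)) = fun y ↦ inner ℝ (Y y) (X y) :=
  funext fun _ ↦ real_inner_comm _ _

variable {X X' Y Y' Z Z' : Π x : M, TangentSpace I x} {x : M}

section koszul

variable [IsContMDiffRiemannianBundle I ∞ E (fun x : M ↦ TangentSpace I x)]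

theorem mdifferentiableAt_inner (hX : MDiffAt (T% X) x) (hY : MDiffAt (T% Y) x) :
    MDiffAt (fun y ↦ (inner ℝ (X y) (Y y) : ℝ)) x :=
  MDifferentiableAt.inner_bundle (E := fun x : M ↦ TangentSpace I x) hX hY

variable [FiniteDimensional ℝ E]

theorem koszul_smul_left {f : M → ℝ} (hf : MDiffAt f x) (hX : MDiffAt (T% X) x)
    (hY : MDiffAt (T% Y) x) (hZ : MDiffAt (T% Z) x) :
    koszul (f • X) Y Z x = f x * koszul X Y Z x := by
  have h1 := mvfderiv_fun_mul hf (mdifferentiableAt_inner hZ hX)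
  have h2 := mvfderiv_fun_mul hf (mdifferentiableAt_inner hX hY)
  simp [koszul, VectorField.mlieBracket_smul_left hf hX, inner_smul_left, inner_smul_right,
    inner_add_right, h1, h2]
  rw [real_inner_comm (Y x) (X x)]
  ring

theorem koszul_add_left (hX : MDiffAt (T% X) x) (hX' : MDiffAt (T% X') x)
    (hY : MDiffAt (T% Y) x) (hZ : MDiffAt (T% Z) x) :
    koszul (X + X') Y Z x = koszul X Y Z x + koszul X' Y Z x := by
  have h1 := mvfderiv_fun_add (mdifferentiableAt_inner hZ hX) (mdifferentiableAt_inner hZ hX')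
  have h2 := mvfderiv_fun_add (mdifferentiableAt_inner hX hY) (mdifferentiableAt_inner hX' hY)
  simp [koszul, VectorField.mlieBracket_add_left hX hX',
    inner_add_right, inner_add_left, h1, h2]
  ring

theorem koszul_smul_right {f : M → ℝ} (hf : MDiffAt f x) (hX : MDiffAt (T% X) x)
    (hY : MDiffAt (T% Y) x) (hZ : MDiffAt (T% Z) x) :
    koszul X Y (f • Z) x = f x * koszul X Y Z x := by
  have h1 := mvfderiv_fun_mul hf (mdifferentiableAt_inner hZ hX)
  have h2 := mvfderiv_fun_mul hf (mdifferentiableAt_inner hY hZ)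
  simp [koszul, VectorField.mlieBracket_smul_right hf hZ, inner_smul_left, inner_smul_right,
    inner_add_right, h1, h2]
  rw [real_inner_comm (Z x) (X x), real_inner_comm (Z x) (Y x)]
  ring

theorem koszul_add_right (hX : MDiffAt (T% X) x) (hY : MDiffAt (T% Y) x)
    (hZ : MDiffAt (T% Z) x) (hZ' : MDiffAt (T% Z') x) :
    koszul X Y (Z + Z') x = koszul X Y Z x + koszul X Y Z' x := by
  have h1 := mvfderiv_fun_add (mdifferentiableAt_inner hZ hX) (mdifferentiableAt_inner hZ' hX)
  have h2 := mvfderiv_fun_add (mdifferentiableAt_inner hY hZ) (mdifferentiableAt_inner hY hZ')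
  simp [koszul, VectorField.mlieBracket_add_right hZ hZ',
    inner_add_right, inner_add_left, h1, h2]
  ring

theorem koszul_smul_mid {f : M → ℝ} (hf : MDiffAt f x) (hX : MDiffAt (T% X) x)
    (hY : MDiffAt (T% Y) x) (hZ : MDiffAt (T% Z) x) :
    koszul X (f • Y) Z x = f x * koszul X Y Z x
      + 2 * (mvfderiv I f x (X x) * inner ℝ (Y x) (Z x)) := by
  have h1 := mvfderiv_fun_mul hf (mdifferentiableAt_inner hX hY)
  have h2 := mvfderiv_fun_mul hf (mdifferentiableAt_inner hY hZ)
  simp [koszul, VectorField.mlieBracket_smul_right hf hY, VectorField.mlieBracket_smul_left hf hY,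
    inner_smul_left, inner_smul_right, inner_add_right, h1, h2]
  rw [real_inner_comm (Y x) (X x), real_inner_comm (Z x) (Y x)]
  ring

theorem koszul_add_mid (hX : MDiffAt (T% X) x) (hY : MDiffAt (T% Y) x)
    (hY' : MDiffAt (T% Y') x) (hZ : MDiffAt (T% Z) x) :
    koszul X (Y + Y') Z x = koszul X Y Z x + koszul X Y' Z x := by
  have h1 := mvfderiv_fun_add (mdifferentiableAt_inner hX hY) (mdifferentiableAt_inner hX hY')
  have h2 := mvfderiv_fun_add (mdifferentiableAt_inner hY hZ) (mdifferentiableAt_inner hY' hZ)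
  simp [koszul, VectorField.mlieBracket_add_right hY hY', VectorField.mlieBracket_add_left hY hY',
    inner_add_right, inner_add_left, h1, h2]
  ring

theorem koszul_tensorial_left (hY : MDiffAt (T% Y) x) (hZ : MDiffAt (T% Z) x) :
    TensorialAt I E (fun X : Π x : M, TangentSpace I x ↦ koszul X Y Z x) x where
  smul hf hX := koszul_smul_left hf hX hY hZ
  add hX hX' := koszul_add_left hX hX' hY hZ

theorem koszul_tensorial_right (hX : MDiffAt (T% X) x) (hY : MDiffAt (T% Y) x) :
    TensorialAt I E (fun Z : Π x : M, TangentSpace I x ↦ koszul X Y Z x) x where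
  smul hf hZ := koszul_smul_right hf hX hY hZ
  add hZ hZ' := koszul_add_right hX hY hZ hZ'

end koszul

variable [FiniteDimensional ℝ E]

instance instFiniteDimensionalTangentSpace (x : M) : FiniteDimensional ℝ (TangentSpace I x) :=
  inferInstanceAs (FiniteDimensional ℝ E)

/-- An orthonormal basis of the tangent space at `x`. -/
def frame (x : M) :
    OrthonormalBasis (Fin (Module.finrank ℝ (TangentSpace I x))) ℝ (TangentSpace I x) :=
  stdOrthonormalBasis ℝ (TangentSpace I x)

variable [IsContMDiffRiemannianBundle I ∞ E (fun x : M ↦ TangentSpace I x)]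

open scoped Classical in
/-- `leviCivitaFun Y x (X x)` is `(∇_X Y)(x) = ∑ i, g(∇_X Y, e_i) e_i`, with `2 g(∇_X Y, e_i)` given
by the Koszul formula. The value is the junk value `0` if `Y` is not differentiable at `x`. -/
def leviCivitaFun (Y : Π x : M, TangentSpace I x) (x : M) :
    TangentSpace I x →L[ℝ] TangentSpace I x :=
  if hY : MDiffAt (T% Y) x then
    ∑ i, ((1 / 2 : ℝ) • TensorialAt.mkHom _ x
      (koszul_tensorial_left hY (mdifferentiableAt_extend_tangent (frame x i)))).smulRight
        (frame x i)
  else 0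

/-- The Koszul formula. -/
theorem two_mul_inner_leviCivitaFun (hX : MDiffAt (T% X) x) (hY : MDiffAt (T% Y) x)
    (hZ : MDiffAt (T% Z) x) :
    2 * inner ℝ (leviCivitaFun Y x (X x)) (Z x) = koszul X Y Z x := by
  have h : koszul X Y Z x
      = TensorialAt.mkHom _ x (koszul_tensorial_right hX hY) (Z x) :=
    (TensorialAt.mkHom_apply (koszul_tensorial_right hX hY) hZ).symm
  have h' (i) : TensorialAt.mkHom _ x
      (koszul_tensorial_left hY (mdifferentiableAt_extend_tangent (frame x i))) (X x)
      = TensorialAt.mkHom _ x (koszul_tensorial_right hX hY) (frame x i) :=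
    TensorialAt.mkHom_apply
      (koszul_tensorial_left hY (mdifferentiableAt_extend_tangent (frame x i))) hX
  rw [h]
  conv_rhs => rw [← (frame x).sum_repr' (Z x)]
  rw [map_sum, leviCivitaFun, dif_pos hY, sum_apply, sum_inner, Finset.mul_sum]
  refine Finset.sum_congr rfl fun i _ ↦ ?_
  rw [ContinuousLinearMap.smulRight_apply, smul_apply, h', map_smul, real_inner_smul_left]
  simp only [smul_eq_mul]
  ring

theorem leviCivitaFun_ext (A B : TangentSpace I x →L[ℝ] TangentSpace I x)
    (h : ∀ X Z : Π y : M, TangentSpace I y, MDiffAt (T% X) x → MDiffAt (T% Z) x →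
      2 * (inner ℝ (A (X x)) (Z x) : ℝ) = 2 * inner ℝ (B (X x)) (Z x)) : A = B := by
  ext u
  refine ext_inner_right ℝ fun v ↦ ?_
  have := h (extend E u) (extend E v) (mdifferentiableAt_extend_tangent u)
    (mdifferentiableAt_extend_tangent v)
  simp only [extend_apply_self] at this
  linarith

variable (I M) in
/-- The Levi-Civita connection `∇` of the metric. Its value `∇_X Y` at `x` is written
`leviCivita I M Y x (X x)`. -/
def leviCivita : CovariantDerivative I E (fun x : M ↦ TangentSpace I x) where
  toFun := leviCivitaFun
  isCovariantDerivativeOnUniv :=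
    { add := by
        intro σ σ' x hσ hσ' _
        refine leviCivitaFun_ext _ _ fun X Z hX hZ ↦ ?_
        have hs : MDiffAt (T% (σ + σ')) x := mdifferentiableAt_add_section hσ hσ'
        rw [two_mul_inner_leviCivitaFun hX hs hZ, koszul_add_mid hX hσ hσ' hZ, add_apply,
          inner_add_left, mul_add, two_mul_inner_leviCivitaFun hX hσ hZ,
          two_mul_inner_leviCivitaFun hX hσ' hZ]
      leibniz := by
        intro σ f x hσ hf _
        refine leviCivitaFun_ext _ _ fun X Z hX hZ ↦ ?_
        have hs : MDiffAt (T% (f • σ)) x := hf.smul_section hσ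
        rw [two_mul_inner_leviCivitaFun hX hs hZ, koszul_smul_mid hf hX hσ hZ, add_apply,
          inner_add_left, smul_apply, real_inner_smul_left,
          ContinuousLinearMap.smulRight_apply, real_inner_smul_left, mul_add,
          ← two_mul_inner_leviCivitaFun hX hσ hZ]
        ring }

/-- The Levi-Civita connection is torsion free. -/
theorem leviCivita_torsion_free (hX : MDiffAt (T% X) x) (hY : MDiffAt (T% Y) x) :
    leviCivita I M Y x (X x) - leviCivita I M X x (Y x) = VectorField.mlieBracket I X Y x := by
  refine ext_inner_right ℝ fun v ↦ ?_
  have hv := mdifferentiableAt_extend_tangent v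
  have h1 := two_mul_inner_leviCivitaFun hX hY hv
  have h2 := two_mul_inner_leviCivitaFun hY hX hv
  simp only [koszul, extend_apply_self] at h1 h2
  rw [VectorField.mlieBracket_swap_apply (V := Y) (W := X), inner_neg_right] at h2
  rw [inner_comm_fun X (extend E v), inner_comm_fun (extend E v) Y, inner_comm_fun Y X] at h2
  have h3 := real_inner_comm (VectorField.mlieBracket I X Y x) v
  rw [inner_sub_left]
  change (inner ℝ (leviCivitaFun Y x (X x)) v : ℝ) - inner ℝ (leviCivitaFun X x (Y x)) v = _
  linarith

/-- The Levi-Civita connection is compatible with the metric. -/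
theorem leviCivita_metric (hX : MDiffAt (T% X) x) (hY : MDiffAt (T% Y) x)
    (hZ : MDiffAt (T% Z) x) :
    mvfderiv I (fun y ↦ (inner ℝ (Y y) (Z y) : ℝ)) x (X x)
      = inner ℝ (leviCivita I M Y x (X x)) (Z x) + inner ℝ (Y x) (leviCivita I M Z x (X x)) := by
  have h1 := two_mul_inner_leviCivitaFun hX hY hZ
  have h2 := two_mul_inner_leviCivitaFun hX hZ hY
  simp only [koszul] at h1 h2
  rw [VectorField.mlieBracket_swap_apply (V := Z) (W := Y), inner_neg_right,
    inner_comm_fun Z Y, inner_comm_fun Y X, inner_comm_fun X Z] at h2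
  have h3 := real_inner_comm (Y x) (leviCivitaFun Z x (X x))
  change _ = (inner ℝ (leviCivitaFun Y x (X x)) (Z x) : ℝ)
    + inner ℝ (Y x) (leviCivitaFun Z x (X x))
  linarith

/-! ### Curvature -/

/-- The curvature operator `R(X,Y)Z = ∇_X ∇_Y Z - ∇_Y ∇_X Z - ∇_[X,Y] Z` on vector fields. -/
def curvatureField (X Y Z : Π x : M, TangentSpace I x) (x : M) : TangentSpace I x :=
  leviCivita I M (fun y ↦ leviCivita I M Z y (Y y)) x (X x)
    - leviCivita I M (fun y ↦ leviCivita I M Z y (X y)) x (Y x)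
    - leviCivita I M Z x (VectorField.mlieBracket I X Y x)

/-- The curvature tensor `R(u,v)w` at `x`: the curvature operator applied to vector fields that are
smooth near `x` and extend `u`, `v`, `w`. (They have constant coefficients in the trivialization of
the tangent bundle at `x`; the value does not depend on the extensions.) -/
def curvature (x : M) (u v w : TangentSpace I x) : TangentSpace I x :=
  curvatureField (extend E u : Π y : M, TangentSpace I y) (extend E v) (extend E w) x

/-- The trace of an endomorphism of the tangent space at `x`, computed in an orthonormal basis. -/
def traceAt (x : M) (f : TangentSpace I x → TangentSpace I x) : ℝ :=
  ∑ i, inner ℝ (f (frame x i)) (frame x i)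

/-- The Ricci tensor `S(v,w)`, the trace of `u ↦ R(u,v)w`. -/
def ricci (x : M) (v w : TangentSpace I x) : ℝ :=
  traceAt x fun u ↦ curvature x u v w

variable (I) in
/-- The scalar curvature `r = tr S`. -/
def scalarCurvature (x : M) : ℝ :=
  ∑ i, ricci x (frame x i : TangentSpace I x) (frame x i)

/-- The pseudo-projective curvature tensor with constants `a`, `b` on a manifold of dimension `N`:
`a R(u,v)w + b (S(v,w)u - S(u,w)v) - (r/N) (a/(N-1) + b) (g(v,w)u - g(u,w)v)`. -/
def pseudoProjective (a b : ℝ) (x : M) (u v w : TangentSpace I x) : TangentSpace I x :=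
  a • curvature x u v w + b • (ricci x v w • u - ricci x u w • v)
    - (scalarCurvature I x / (Module.finrank ℝ E : ℝ)
        * (a / ((Module.finrank ℝ E : ℝ) - 1) + b))
      • ((inner ℝ v w : ℝ) • u - (inner ℝ u w : ℝ) • v)

/-- The derivation action of an endomorphism `T` of the tangent space on a `(0,2)`-tensor `B`:
`(T · B)(v,w) = - B(Tv,w) - B(v,Tw)`. -/
def derivationAction {x : M} (T : TangentSpace I x → TangentSpace I x)
    (B : TangentSpace I x → TangentSpace I x → ℝ) (v w : TangentSpace I x) : ℝ :=
  - B (T v) w - B v (T w)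

/-- The Lie derivative of the metric:
`(L_V g)(X,Y) = V g(X,Y) - g([V,X],Y) - g(X,[V,Y])`. -/
def lieDerivMetric (V X Y : Π x : M, TangentSpace I x) (x : M) : ℝ :=
  mvfderiv I (fun y ↦ (inner ℝ (X y) (Y y) : ℝ)) x (V x)
    - inner ℝ (VectorField.mlieBracket I V X x) (Y x)
    - inner ℝ (X x) (VectorField.mlieBracket I V Y x)

/-! ### Sasakian structures -/

variable (I M) in
/-- An almost contact metric structure `(φ, ξ, η, g)` of class `C^∞`, for the given metric `g`. -/
structure AlmostContactMetric where
  phi : Π x : M, TangentSpace I x →L[ℝ] TangentSpace I x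
  xi : Π x : M, TangentSpace I x
  eta : Π x : M, TangentSpace I x →L[ℝ] ℝ
  contMDiff_phi : ContMDiff I (I.prod 𝓘(ℝ, E →L[ℝ] E)) ∞
    (fun x ↦ TotalSpace.mk' (E →L[ℝ] E)
      (E := fun x : M ↦ TangentSpace I x →L[ℝ] TangentSpace I x) x (phi x))
  contMDiff_xi : ContMDiff I (I.prod 𝓘(ℝ, E)) ∞
    (fun x ↦ TotalSpace.mk' E (E := fun x : M ↦ TangentSpace I x) x (xi x))
  contMDiff_eta : ContMDiff I (I.prod 𝓘(ℝ, E →L[ℝ] ℝ)) ∞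
    (fun x ↦ TotalSpace.mk' (E →L[ℝ] ℝ) (E := fun x : M ↦ TangentSpace I x →L[ℝ] ℝ) x (eta x))
  phi_phi : ∀ (x : M) (u : TangentSpace I x), phi x (phi x u) = - u + eta x u • xi x
  eta_xi : ∀ x : M, eta x (xi x) = 1
  eta_phi : ∀ (x : M) (u : TangentSpace I x), eta x (phi x u) = 0
  phi_xi : ∀ x : M, phi x (xi x) = 0
  inner_phi_phi : ∀ (x : M) (u v : TangentSpace I x),
    (inner ℝ (phi x u) (phi x v) : ℝ) = inner ℝ u v - eta x u * eta x v
  inner_phi : ∀ (x : M) (u v : TangentSpace I x),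
    (inner ℝ u (phi x v) : ℝ) = - inner ℝ (phi x u) v
  inner_xi : ∀ (x : M) (u : TangentSpace I x), (inner ℝ u (xi x) : ℝ) = eta x u

namespace AlmostContactMetric

variable (A : AlmostContactMetric I M)

/-- The exterior derivative of `η`, with the convention
`dη(X,Y) = (1/2) (X η(Y) - Y η(X) - η([X,Y]))`. -/
def dEta (X Y : Π x : M, TangentSpace I x) (x : M) : ℝ :=
  (1 / 2) * (mvfderiv I (fun y ↦ A.eta y (Y y)) x (X x)
    - mvfderiv I (fun y ↦ A.eta y (X y)) x (Y x)
    - A.eta x (VectorField.mlieBracket I X Y x))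

/-- The Nijenhuis tensor of `φ`:
`[φ,φ](X,Y) = φ²[X,Y] + [φX,φY] - φ[φX,Y] - φ[X,φY]`. -/
def nijenhuis (X Y : Π x : M, TangentSpace I x) (x : M) : TangentSpace I x :=
  A.phi x (A.phi x (VectorField.mlieBracket I X Y x))
    + VectorField.mlieBracket I (fun y ↦ A.phi y (X y)) (fun y ↦ A.phi y (Y y)) x
    - A.phi x (VectorField.mlieBracket I (fun y ↦ A.phi y (X y)) Y x)
    - A.phi x (VectorField.mlieBracket I X (fun y ↦ A.phi y (Y y)) x)

/-- A contact metric structure: `dη(X,Y) = g(X,φY)`. -/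
def IsContactMetric : Prop :=
  ∀ (X Y : Π x : M, TangentSpace I x) (x : M), MDiffAt (T% X) x → MDiffAt (T% Y) x →
    A.dEta X Y x = inner ℝ (X x) (A.phi x (Y x))

/-- A normal structure: `2 dη(X,Y) ξ + [φ,φ](X,Y) = 0`. -/
def IsNormal : Prop :=
  ∀ (X Y : Π x : M, TangentSpace I x) (x : M), MDiffAt (T% X) x → MDiffAt (T% Y) x →
    (2 * A.dEta X Y x) • A.xi x + A.nijenhuis X Y x = 0

/-- A Sasakian structure is a normal contact metric structure. -/
def IsSasakian : Prop := A.IsContactMetric ∧ A.IsNormal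

/-- The `*`-Ricci tensor `S*(v,w) = (1/2) trace (φ ∘ R(v,φw))`. -/
def starRicci (x : M) (v w : TangentSpace I x) : ℝ :=
  (1 / 2) * traceAt x fun u ↦ A.phi x (curvature x v (A.phi x w) u)

/-- The `*`-conformal `η`-Ricci soliton equation, on a manifold of dimension `N`, with constants
`lam`, `mu` and a scalar field `p`:
`L_ξ g + 2 S* + (2 lam - (p + 2/N)) g + 2 mu η ⊗ η = 0`. -/
def IsStarConformalEtaRicciSoliton (lam mu : ℝ) (p : M → ℝ) : Prop :=
  ∀ (X Y : Π x : M, TangentSpace I x) (x : M), MDiffAt (T% X) x → MDiffAt (T% Y) x →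
    lieDerivMetric A.xi X Y x + 2 * A.starRicci x (X x) (Y x)
      + (2 * lam - (p x + 2 / (Module.finrank ℝ E : ℝ))) * inner ℝ (X x) (Y x)
      + 2 * mu * (A.eta x (X x) * A.eta x (Y x)) = 0

end AlmostContactMetric

end SasakiGeom

end

/-!
The curvature identities of a Sasakian manifold reduce the theorem to arithmetic.

From the contact and normality conditions one gets `∇_X ξ = - φ X` and
`(∇_X φ) Y = g(X,Y) ξ - η(Y) X` (`IsSasakian.leviCivita_xi`, `IsSasakian.leviCivita_phi`). At a
point this is an algebraic statement about the trilinear form `g((∇_X φ) Y, Z)`, proved in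
`eq_neg_and_eq_of_contact_of_normal`; besides the two hypotheses it uses the derivatives of the
algebraic relations between `φ`, `ξ`, `η` and `g`, and the closedness of `dη`
(`IsContactMetric.cyclic_nablaPhi`). Differentiating once more gives
`R(X,Y) ξ = η(Y) X - η(X) Y` and the commutator of `R(X,Y)` with `φ`. Hence `ξ` is a Killing
field, `S(X,ξ) = (N-1) η(X)`, and, through the first Bianchi identity, for a unit vector `v`
orthogonal to `ξ`, `S*(v,v) = (S(v,v) + S(φv,φv)) / 2 - (N-2)`, where `N = 2n+1` is the dimension
(`IsSasakian.starRicci_self`).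

The soliton equation on `(ξ,ξ)`, where `S*` vanishes, says that `λ + μ = (p + 2/N) / 2`. On `(v,v)`
it then says that `S(v,v) + S(φv,φv) = 2 (μ + N - 2)`. The hypothesis `P(ξ,v) · S = 0` on `(v,ξ)`
reads `(a - k) (N - 1 - S(v,v)) = 0` with `k = (r/N) (a/(N-1) + b)`. Adding the same identity for
`φv` gives `(a - k) (1 - μ) = 0`, which is the claim.

The identities for `v` and `φv` are only used through their sum, so no symmetry of `R` under
exchange of the two pairs of arguments is needed: the first Bianchi identity and the skew-symmetry
of `R(X,Y)` suffice. Skew-symmetry also yields the tensoriality of `R(X,Y) Z` in `Z` and of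
`(∇_X φ) Y` in `Y`.
-/

namespace SasakiGeom

open scoped Topology

set_option linter.unusedSectionVars false

/-! ### Pointwise algebra of Sasakian structures -/

section algebra

variable {V : Type*} [NormedAddCommGroup V] [InnerProductSpace ℝ V]
  {φ : V →ₗ[ℝ] V} {ξ : V} {F : V → V → V} {A : V →ₗ[ℝ] V}

/-- The pointwise algebra behind `∇_X ξ = - φ X`. Here `A u` stands for `∇_u ξ`, and `F u v` for
`(∇_u φ) v`. -/
theorem eq_neg_of_contact_of_normal
    (hφφ : ∀ u, φ (φ u) = - u + (inner ℝ u ξ : ℝ) • ξ) (hφξ : φ ξ = 0)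
    (hφ : ∀ u v, (inner ℝ u (φ v) : ℝ) = - inner ℝ (φ u) v)
    (hF : ∀ u v w, (inner ℝ (F u v) w : ℝ) = - inner ℝ v (F u w)) (hF0 : ∀ v, F 0 v = 0)
    (hFξ : ∀ u, F u ξ = - φ (A u)) (hAξ : ∀ u, (inner ℝ (A u) ξ : ℝ) = 0)
    (hd : ∀ u v, (inner ℝ (A u) v : ℝ) - inner ℝ (A v) u = 2 * inner ℝ u (φ v))
    (hN : ∀ u v, F (φ u) v - F (φ v) u + φ (F v u) - φ (F u v)
      = - (2 * inner ℝ u (φ v) : ℝ) • ξ)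
    (hc : ∀ u v w, (inner ℝ (F u v) w : ℝ) + inner ℝ (F v w) u + inner ℝ (F w u) v = 0) (u : V) :
    A u = - φ u := by
  have hA0 : A ξ = 0 := by
    refine ext_inner_right ℝ fun v ↦ ?_
    have h1 := hd ξ v
    have h2 := hφ ξ v
    rw [hφξ, inner_zero_left] at h2
    rw [hAξ, h2] at h1
    rw [inner_zero_left]
    linarith
  have hT (u v : V) : (inner ℝ (F u ξ) v : ℝ) = inner ℝ (A u) (φ v) := by
    rw [hFξ, inner_neg_left, hφ]
  have hTξ (u v : V) :
      (inner ℝ (F ξ u) v : ℝ) = inner ℝ (A u) (φ v) - inner ℝ (A v) (φ u) := by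
    have h1 := hc ξ u v
    have h2 := hF u v ξ
    rw [real_inner_comm (F u ξ) v, hT] at h2
    rw [hT] at h1
    linarith
  have hAφφ (u v : V) : (inner ℝ (A u) (φ (φ v)) : ℝ) = - inner ℝ (A u) v := by
    rw [hφφ, inner_add_right, inner_neg_right, real_inner_smul_right, hAξ]
    ring
  have hanti (u v : V) :
      (inner ℝ (A (φ u)) (φ v) : ℝ) + inner ℝ (A (φ v)) (φ u) = 0 := by
    have h1 := congrArg (fun z ↦ (inner ℝ z v : ℝ)) (hN u ξ)
    simp only [hφξ, inner_zero_right, mul_zero, neg_zero, zero_smul, inner_zero_left,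
      inner_sub_left, inner_add_left] at h1
    have h2 := hφ (F ξ u) v
    have h3 := hφ (F u ξ) v
    rw [hTξ, hAφφ] at h2
    rw [hT, hAφφ] at h3
    rw [hF0, inner_zero_left, hT] at h1
    linarith
  have hred (u v : V) : (inner ℝ (A u) v : ℝ) = inner ℝ (A (φ (φ u))) (φ (φ v)) := by
    rw [hAφφ, hφφ, map_add, map_neg, map_smul, hA0, smul_zero, add_zero, inner_neg_left, neg_neg]
  refine ext_inner_right ℝ fun v ↦ ?_
  have h1 := hanti (φ u) (φ v)
  rw [← hred, ← hred] at h1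
  have h2 := hd u v
  rw [inner_neg_left]
  linarith [hφ u v]

/-- The pointwise algebra behind `(∇_X φ) Y = g(X,Y) ξ - η(Y) X`. Subtracting the right-hand side
from `∇ φ` leaves a tensor with the symmetries of the covariant derivative of a complex structure
that is integrable and has a closed fundamental form, and such a tensor vanishes. -/
theorem eq_of_contact_of_normal (hξ : (inner ℝ ξ ξ : ℝ) = 1)
    (hφφ : ∀ u, φ (φ u) = - u + (inner ℝ u ξ : ℝ) • ξ) (hφξ : φ ξ = 0)
    (hφ : ∀ u v, (inner ℝ u (φ v) : ℝ) = - inner ℝ (φ u) v)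
    (hF : ∀ u v w, (inner ℝ (F u v) w : ℝ) = - inner ℝ v (F u w))
    (hFξ : ∀ u, F u ξ = φ (φ u))
    (hP : ∀ u v, φ (F u v) + F u (φ v) = (inner ℝ (- φ u) v : ℝ) • ξ + (inner ℝ v ξ : ℝ) • (- φ u))
    (hN : ∀ u v, F (φ u) v - F (φ v) u + φ (F v u) - φ (F u v)
      = - (2 * inner ℝ u (φ v) : ℝ) • ξ)
    (hc : ∀ u v w, (inner ℝ (F u v) w : ℝ) + inner ℝ (F v w) u + inner ℝ (F w u) v = 0) (u v : V) :
    F u v = (inner ℝ u v : ℝ) • ξ - (inner ℝ v ξ : ℝ) • u := by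
  have hφη (u : V) : (inner ℝ (φ u) ξ : ℝ) = 0 := by
    have := hφ u ξ
    rw [hφξ, inner_zero_right] at this
    linarith
  let T (u v w : V) : ℝ := inner ℝ (F u v) w
    - (inner ℝ u v * inner ℝ w ξ - inner ℝ v ξ * inner ℝ u w)
  have hTskew (u v w : V) : T u v w = - T u w v := by
    have := hF u v w
    rw [real_inner_comm (F u w) v] at this
    simp only [T]
    linarith
  have hTc (u v w : V) : T u v w + T v w u + T w u v = 0 := by
    have := hc u v w
    simp only [T]
    rw [real_inner_comm u v, real_inner_comm u w, real_inner_comm v w]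
    linarith
  have hTP (u v w : V) : T u (φ v) w = T u v (φ w) := by
    have h1 := congrArg (fun z ↦ (inner ℝ z w : ℝ)) (hP u v)
    simp only [inner_add_left, real_inner_smul_left, inner_neg_left] at h1
    have h2 := hφ (F u v) w
    simp only [T]
    rw [hφη, hφη, hφ u v, hφ u w, real_inner_comm w ξ] at *
    linarith
  have hTN (u v w : V) : T (φ u) v w + T u v (φ w) = T (φ v) u w + T v u (φ w) := by
    have h1 := congrArg (fun z ↦ (inner ℝ z w : ℝ)) (hN u v)
    simp only [inner_add_left, inner_sub_left, real_inner_smul_left] at h1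
    have h2 := hφ (F u v) w
    have h3 := hφ (F v u) w
    simp only [T]
    have h4 := hφ u v
    rw [hφ u v, real_inner_comm w ξ] at h1
    rw [real_inner_comm (φ v) u] at h4
    rw [hφη, hφ u w, hφ v w, h4]
    linarith
  have hTξ (u w : V) : T u ξ w = 0 := by
    simp only [T]
    rw [hFξ, hφφ, hξ, inner_add_left, inner_neg_left, real_inner_smul_left, real_inner_comm w ξ]
    ring
  -- The left-hand side is symmetric in `u`, `v` by `hTN` and skew in `v`, `w`, hence zero.
  have hQ (u v w : V) : T (φ u) v w + T u v (φ w) = 0 := by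
    have hskew (u v w : V) : T (φ u) v w + T u v (φ w) = - (T (φ u) w v + T u w (φ v)) := by
      rw [hTskew (φ u) v w, hTskew u v (φ w), hTP]
      ring
    linarith [hTN u v w, hskew v u w, hTN v w u, hskew w v u, hTN w u v, hskew u w v]
  have hTφ (u v w : V) : T u (φ v) w = 0 := by
    have h1 := hTc (φ w) u v
    have h2 := hTc w u (φ v)
    linarith [hQ w u v, hTP u v w, hQ v w u, hTP v w u]
  have hT0 (u v w : V) : T u v w = 0 := by
    have h1 := hTφ u (φ v) w
    rw [hTskew, hφφ] at h1
    have h2 : T u w (- v + (inner ℝ v ξ : ℝ) • ξ) = - T u w v + inner ℝ v ξ * T u w ξ := by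
      simp only [T, inner_add_right, inner_neg_right, real_inner_smul_right, inner_add_left,
        inner_neg_left, real_inner_smul_left]
      ring
    rw [h2, hTskew u w ξ, hTξ] at h1
    linarith [hTskew u v w]
  refine ext_inner_right ℝ fun w ↦ ?_
  have := hT0 u v w
  simp only [T] at this
  rw [inner_sub_left, real_inner_smul_left, real_inner_smul_left, real_inner_comm w ξ]
  linarith

theorem eq_neg_and_eq_of_contact_of_normal (hξ : (inner ℝ ξ ξ : ℝ) = 1)
    (hφφ : ∀ u, φ (φ u) = - u + (inner ℝ u ξ : ℝ) • ξ) (hφξ : φ ξ = 0)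
    (hφ : ∀ u v, (inner ℝ u (φ v) : ℝ) = - inner ℝ (φ u) v)
    (hF : ∀ u v w, (inner ℝ (F u v) w : ℝ) = - inner ℝ v (F u w)) (hF0 : ∀ v, F 0 v = 0)
    (hFξ : ∀ u, F u ξ = - φ (A u)) (hAξ : ∀ u, (inner ℝ (A u) ξ : ℝ) = 0)
    (hP : ∀ u v, φ (F u v) + F u (φ v) = (inner ℝ (A u) v : ℝ) • ξ + (inner ℝ v ξ : ℝ) • A u)
    (hd : ∀ u v, (inner ℝ (A u) v : ℝ) - inner ℝ (A v) u = 2 * inner ℝ u (φ v))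
    (hN : ∀ u v, F (φ u) v - F (φ v) u + φ (F v u) - φ (F u v)
      = - (2 * inner ℝ u (φ v) : ℝ) • ξ)
    (hc : ∀ u v w, (inner ℝ (F u v) w : ℝ) + inner ℝ (F v w) u + inner ℝ (F w u) v = 0) :
    (∀ u, A u = - φ u) ∧
      ∀ u v, F u v = (inner ℝ u v : ℝ) • ξ - (inner ℝ v ξ : ℝ) • u := by
  have hA := eq_neg_of_contact_of_normal hφφ hφξ hφ hF hF0 hFξ hAξ hd hN hc
  simp only [hA] at hFξ hP
  refine ⟨hA, eq_of_contact_of_normal hξ hφφ hφξ hφ hF (fun u ↦ ?_) hP hN hc⟩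
  rw [hFξ, map_neg, neg_neg]

end algebra

variable {E : Type*} [NormedAddCommGroup E] [NormedSpace ℝ E]
  {H : Type*} [TopologicalSpace H] {I : ModelWithCorners ℝ E H}
  {M : Type*} [TopologicalSpace M] [ChartedSpace H M] [IsManifold I ∞ M]
  [RiemannianBundle (fun x : M ↦ TangentSpace I x)]
  [IsContMDiffRiemannianBundle I ∞ E (fun x : M ↦ TangentSpace I x)]
  [FiniteDimensional ℝ E]
  {X Y Z W : Π x : M, TangentSpace I x} {x : M}

/-! ### Smoothness of the Levi-Civita connection -/

theorem contMDiffAt_inner (hX : CMDiffAt ∞ (T% X) x) (hY : CMDiffAt ∞ (T% Y) x) :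
    CMDiffAt ∞ (fun y ↦ (inner ℝ (X y) (Y y) : ℝ)) x :=
  ContMDiffAt.inner_bundle (E := fun x : M ↦ TangentSpace I x) hX hY

/-- The Gram-Schmidt process turns a smooth local frame into a smooth local orthogonal frame. -/
theorem exists_orthogonal_frame (x : M) :
    ∃ F : Fin (Module.finrank ℝ E) → Π y : M, TangentSpace I y,
      (∀ i, CMDiffAt ∞ (T% (F i)) x) ∧
      (∀ᶠ y in 𝓝 x, ∀ i, F i y ≠ 0) ∧
      ∀ᶠ y in 𝓝 x, ∀ v : TangentSpace I y,
        ∑ i, (inner ℝ (F i y) v / inner ℝ (F i y) (F i y) : ℝ) • F i y = v := by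
  let e := trivializationAt E (fun y : M ↦ TangentSpace I y) x
  let b := Module.finBasis ℝ E
  have hx : x ∈ e.baseSet := mem_baseSet_trivializationAt' x
  have hnhds : ∀ᶠ y in 𝓝 x, y ∈ e.baseSet := e.open_baseSet.mem_nhds hx
  have hfr : IsLocalFrameOn I E ∞ (e.localFrame b) e.baseSet :=
    e.isLocalFrameOn_localFrame_baseSet I ∞ b
  let F : Fin (Module.finrank ℝ E) → Π y : M, TangentSpace I y := fun i y ↦
    InnerProductSpace.gramSchmidt ℝ (fun j ↦ e.localFrame b j y) i
  have hne : ∀ y ∈ e.baseSet, ∀ i, F i y ≠ 0 := fun y hy i ↦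
    InnerProductSpace.gramSchmidt_ne_zero i (hfr.linearIndependent hy)
  refine ⟨F, fun i ↦ ?_, hnhds.mono hne, hnhds.mono fun y hy v ↦ ?_⟩
  · induction i using WellFoundedLT.induction with
    | ind i ih =>
      have h0 : F i = e.localFrame b i - ∑ j ∈ Finset.Iio i,
          (fun y ↦ (inner ℝ (F j y) (e.localFrame b i y) / inner ℝ (F j y) (F j y) : ℝ)) • F j := by
        funext y
        simp only [F]
        rw [InnerProductSpace.gramSchmidt_def]
        simp only [Submodule.starProjection_singleton, Pi.sub_apply, Finset.sum_apply,
          Pi.smul_apply', real_inner_self_eq_norm_sq]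
        rfl
      have hi : CMDiffAt ∞ (T% (e.localFrame b i)) x := hfr.contMDiffAt e.open_baseSet hx i
      rw [h0]
      refine hi.sub_section ?_
      simp only [Finset.sum_apply]
      refine ContMDiffAt.sum_section fun j hj ↦ ?_
      have hj' := ih j (Finset.mem_Iio.mp hj)
      exact ((contMDiffAt_inner hj' hi).div₀ (contMDiffAt_inner hj' hj')
        (inner_self_ne_zero.mpr (hne x hx j))).smul_section hj'
  · have hli := hfr.linearIndependent hy
    have hcard : Module.finrank ℝ (TangentSpace I y) = Fintype.card (Fin (Module.finrank ℝ E)) := by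
      rw [Fintype.card_fin]; rfl
    have hB (i) : InnerProductSpace.gramSchmidtOrthonormalBasis hcard
        (fun j ↦ e.localFrame b j y) i = ‖F i y‖⁻¹ • F i y := by
      rw [InnerProductSpace.gramSchmidtOrthonormalBasis_apply]
      · rfl
      · rw [← norm_ne_zero_iff, InnerProductSpace.gramSchmidtNormed_unit_length i hli]
        exact one_ne_zero
    conv_rhs => rw [← (InnerProductSpace.gramSchmidtOrthonormalBasis hcard
        (fun j ↦ e.localFrame b j y)).sum_repr' v]
    refine Finset.sum_congr rfl fun i _ ↦ ?_
    rw [hB, real_inner_smul_left, smul_smul, real_inner_self_eq_norm_sq]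
    congr 1
    have : ‖F i y‖ ≠ 0 := norm_ne_zero_iff.mpr (hne y hy i)
    field_simp

/-- A vector field is smooth as soon as its inner products with smooth vector fields are. -/
theorem contMDiffAt_of_inner
    (h : ∀ W : Π y : M, TangentSpace I y, CMDiffAt ∞ (T% W) x →
      CMDiffAt ∞ (fun y ↦ (inner ℝ (W y) (X y) : ℝ)) x) :
    CMDiffAt ∞ (T% X) x := by
  obtain ⟨F, hF, hF0, hsum⟩ := exists_orthogonal_frame (I := I) x
  have h0 : ∀ i, F i x ≠ 0 := hF0.self_of_nhds
  have key : CMDiffAt ∞ (T% (fun y ↦ ∑ i,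
      ((fun y ↦ (inner ℝ (F i y) (X y) / inner ℝ (F i y) (F i y) : ℝ)) • F i) y)) x := by
    refine ContMDiffAt.sum_section fun i _ ↦ ?_
    exact ((h _ (hF i)).div₀ (contMDiffAt_inner (hF i) (hF i))
        (inner_self_ne_zero.mpr (h0 i))).smul_section (hF i)
  refine key.congr_of_eventuallyEq (hsum.mono fun y hy ↦ ?_)
  simp only [Pi.smul_apply']
  rw [hy]

theorem eventually_mdifferentiableAt {E' : Type*} [NormedAddCommGroup E'] [NormedSpace ℝ E']
    {H' : Type*} [TopologicalSpace H'] {I' : ModelWithCorners ℝ E' H'}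
    {M' : Type*} [TopologicalSpace M'] [ChartedSpace H' M'] [IsManifold I' 1 M'] {f : M → M'}
    (hf : ContMDiffAt I I' ∞ f x) : ∀ᶠ y in 𝓝 x, MDifferentiableAt I I' f y :=
  ((contMDiffAt_iff_contMDiffAt_nhds (n := 1) (by simp)).mp (hf.of_le (mod_cast le_top))).mono
    fun _ hy ↦ hy.mdifferentiableAt one_ne_zero

theorem contMDiffAt_mlieBracket (hX : CMDiffAt ∞ (T% X) x) (hY : CMDiffAt ∞ (T% Y) x) :
    CMDiffAt ∞ (T% (VectorField.mlieBracket I X Y)) x := by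
  have : IsManifold I (minSmoothness ℝ 2) M := by
    rw [minSmoothness_of_isRCLikeNormedField]; infer_instance
  have : IsManifold I (((⊤ : ℕ∞) : ℕ∞ω) + 1) M := inferInstanceAs (IsManifold I ∞ M)
  exact ContMDiffAt.mlieBracket_vectorField (m := ⊤) (n := ⊤) hX hY (by simp)

theorem contMDiffAt_mvfderiv_apply {f : M → ℝ} (hf : CMDiffAt ∞ f x)
    (hX : CMDiffAt ∞ (T% X) x) :
    CMDiffAt ∞ (fun y ↦ mvfderiv I f y (X y)) x := by
  rcases subsingleton_or_nontrivial E with hE | hE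
  · have : (fun y ↦ mvfderiv I f y (X y)) = fun _ ↦ 0 := by
      funext y
      rw [show X y = 0 from hE.elim _ _, map_zero]
    rw [this]
    exact contMDiffAt_const
  -- The function is the coefficient of `Z` in `[X, f Z] - f [X, Z]`, for a nonvanishing `Z`.
  obtain ⟨v, hv⟩ : ∃ v : TangentSpace I x, v ≠ 0 := exists_ne (0 : E)
  let Z : Π y : M, TangentSpace I y := extend E v
  have hZ : CMDiffAt ∞ (T% Z) x := contMDiffAt_extend I E v
  have hZx : Z x = v := by simp [Z]
  have h1 := contMDiffAt_inner hZ ((contMDiffAt_mlieBracket hX (hf.smul_section hZ)).sub_section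
    (hf.smul_section (contMDiffAt_mlieBracket hX hZ)))
  have h2 := contMDiffAt_inner hZ hZ
  have hne : (inner ℝ (Z x) (Z x) : ℝ) ≠ 0 := inner_self_ne_zero.mpr (hZx ▸ hv)
  refine (h1.div₀ h2 hne).congr_of_eventuallyEq ?_
  have hne' : ∀ᶠ y in 𝓝 x, (inner ℝ (Z y) (Z y) : ℝ) ≠ 0 :=
    h2.continuousAt.eventually_ne hne
  filter_upwards [eventually_mdifferentiableAt hf, eventually_mdifferentiableAt hZ, hne']
    with y hf hZ h0
  simp only [Pi.div_apply]
  rw [eq_div_iff h0]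
  simp [VectorField.mlieBracket_smul_right hf hZ, inner_smul_right]

theorem contMDiffAt_koszul (hX : CMDiffAt ∞ (T% X) x) (hY : CMDiffAt ∞ (T% Y) x)
    (hZ : CMDiffAt ∞ (T% Z) x) : CMDiffAt ∞ (koszul X Y Z) x :=
  (((((contMDiffAt_mvfderiv_apply (contMDiffAt_inner hY hZ) hX).add
    (contMDiffAt_mvfderiv_apply (contMDiffAt_inner hZ hX) hY)).sub
    (contMDiffAt_mvfderiv_apply (contMDiffAt_inner hX hY) hZ)).sub
    (contMDiffAt_inner hX (contMDiffAt_mlieBracket hY hZ))).sub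
    (contMDiffAt_inner hY (contMDiffAt_mlieBracket hX hZ))).add
    (contMDiffAt_inner hZ (contMDiffAt_mlieBracket hX hY))

theorem _root_.ContMDiff.mdifferentiableAt_section (hX : CMDiff ∞ (T% X)) (x : M) :
    MDiffAt (T% X) x :=
  (hX x).mdifferentiableAt (by simp)

/-- The covariant derivative of a smooth vector field along a smooth vector field is smooth. -/
theorem contMDiff_leviCivita (hX : CMDiff ∞ (T% X)) (hY : CMDiff ∞ (T% Y)) :
    CMDiff ∞ (T% (fun y ↦ leviCivita I M Y y (X y))) := by
  refine fun x ↦ contMDiffAt_of_inner fun W hW ↦ ?_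
  have h := (contMDiffAt_const (c := (2 : ℝ)⁻¹)).mul (contMDiffAt_koszul (hX x) (hY x) hW)
  refine h.congr_of_eventuallyEq ?_
  filter_upwards [eventually_mdifferentiableAt hW] with y hy
  change _ = 2⁻¹ * koszul X Y W y
  rw [← two_mul_inner_leviCivitaFun (hX.mdifferentiableAt_section y)
    (hY.mdifferentiableAt_section y) hy, real_inner_comm]
  change (inner ℝ (leviCivitaFun Y y (X y)) (W y) : ℝ) = _
  ring

/-- Every tangent vector extends to a global smooth vector field. -/
theorem exists_contMDiff_eventuallyEq_extend [T2Space M] (v : TangentSpace I x) :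
    ∃ V : Π y : M, TangentSpace I y, CMDiff ∞ (T% V) ∧ V x = v ∧
      ∀ᶠ y in 𝓝 x, V y = extend E v y := by
  obtain ⟨s, hs, hV⟩ := exists_contMDiffOn_extend (k := ∞) I E v
  obtain ⟨f, -, hf⟩ := (SmoothBumpFunction.nhds_basis_tsupport (I := I) x).mem_iff.mp
    (interior_mem_nhds.mpr hs)
  refine ⟨(f : M → ℝ) • (extend E v : Π y : M, TangentSpace I y),
    f.contMDiff.contMDiffOn.smul_section_of_tsupport isOpen_interior hf (hV.mono interior_subset),
    by simp, ?_⟩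
  filter_upwards [f.eventuallyEq_one] with y hy
  simp [hy]

/-! ### The commutator of derivations and the rules for the connection -/

theorem contMDiff_mlieBracket (hX : CMDiff ∞ (T% X)) (hY : CMDiff ∞ (T% Y)) :
    CMDiff ∞ (T% (VectorField.mlieBracket I X Y)) :=
  fun x ↦ contMDiffAt_mlieBracket (hX x) (hY x)

theorem mlieBracket_jacobi (hX : CMDiff ∞ (T% X)) (hY : CMDiff ∞ (T% Y))
    (hZ : CMDiff ∞ (T% Z)) (x : M) :
    VectorField.mlieBracket I X (VectorField.mlieBracket I Y Z) x
      = VectorField.mlieBracket I (VectorField.mlieBracket I X Y) Z x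
        + VectorField.mlieBracket I Y (VectorField.mlieBracket I X Z) x := by
  have : IsManifold I (minSmoothness ℝ 3) M := by
    rw [minSmoothness_of_isRCLikeNormedField]; infer_instance
  have h2 : minSmoothness ℝ 2 ≤ ∞ := by
    rw [minSmoothness_of_isRCLikeNormedField]; exact (mod_cast le_top : ((2 : ℕ∞) : ℕ∞ω) ≤ ∞)
  exact VectorField.leibniz_identity_mlieBracket_apply ((hX x).of_le h2) ((hY x).of_le h2)
    ((hZ x).of_le h2)

/-- The Lie bracket acts on functions as the commutator of derivations. This is the Jacobi
identity for `X`, `Y` and `f Z`, where `Z` does not vanish at the point. -/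
theorem mvfderiv_mlieBracket [T2Space M] {f : M → ℝ} (hf : CMDiff ∞ f)
    (hX : CMDiff ∞ (T% X)) (hY : CMDiff ∞ (T% Y)) (x : M) :
    mvfderiv I f x (VectorField.mlieBracket I X Y x)
      = mvfderiv I (fun y ↦ mvfderiv I f y (Y y)) x (X x)
        - mvfderiv I (fun y ↦ mvfderiv I f y (X y)) x (Y x) := by
  rcases subsingleton_or_nontrivial E with hE | hE
  · have h0 (u : TangentSpace I x) : u = 0 := Subsingleton.elim (α := E) _ _
    rw [h0 (X x), h0 (Y x), h0 (VectorField.mlieBracket I X Y x)]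
    simp
  obtain ⟨v, hv⟩ : ∃ v : TangentSpace I x, v ≠ 0 := exists_ne (0 : E)
  obtain ⟨Z, hZ, hZx, -⟩ := exists_contMDiff_eventuallyEq_extend v
  have hdf (y) : MDiffAt f y := (hf y).mdifferentiableAt (by simp)
  have hfZ := hf.smul_section hZ
  have key {U : Π x : M, TangentSpace I x} :
      VectorField.mlieBracket I U (f • Z)
        = (fun y ↦ mvfderiv I f y (U y)) • Z + f • VectorField.mlieBracket I U Z := by
    funext y
    rw [VectorField.mlieBracket_smul_right (hdf y) (hZ.mdifferentiableAt_section y)]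
    rfl
  have key2 {U V : Π x : M, TangentSpace I x} (hU : CMDiff ∞ (T% U)) (hV : CMDiff ∞ (T% V)) :
      VectorField.mlieBracket I V (VectorField.mlieBracket I U (f • Z)) x
        = mvfderiv I (fun y ↦ mvfderiv I f y (U y)) x (V x) • Z x
          + mvfderiv I f x (U x) • VectorField.mlieBracket I V Z x
          + (mvfderiv I f x (V x) • VectorField.mlieBracket I U Z x
          + f x • VectorField.mlieBracket I V (VectorField.mlieBracket I U Z) x) := by
    have hUf : CMDiff ∞ (fun y ↦ mvfderiv I f y (U y)) :=
      fun y ↦ contMDiffAt_mvfderiv_apply (hf y) (hU y)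
    have hUZ := contMDiff_mlieBracket hU hZ
    rw [key, VectorField.mlieBracket_add_right
      ((hUf.smul_section hZ).mdifferentiableAt_section x)
      ((hf.smul_section hUZ).mdifferentiableAt_section x),
      VectorField.mlieBracket_smul_right ((hUf x).mdifferentiableAt (by simp))
        (hZ.mdifferentiableAt_section x),
      VectorField.mlieBracket_smul_right (hdf x) (hUZ.mdifferentiableAt_section x)]
  have h := mlieBracket_jacobi hX hY hfZ x
  have h' := mlieBracket_jacobi hX hY hZ x
  rw [key2 hY hX, key2 hX hY, key] at h
  simp only [Pi.add_apply, Pi.smul_apply', h'] at h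
  rw [← sub_eq_zero] at h
  have h3 : (mvfderiv I (fun y ↦ mvfderiv I f y (Y y)) x (X x)
        - mvfderiv I (fun y ↦ mvfderiv I f y (X y)) x (Y x)
        - mvfderiv I f x (VectorField.mlieBracket I X Y x)) • Z x = 0 := by
    rw [← h]; module
  have := (smul_eq_zero.mp h3).resolve_right (hZx ▸ hv)
  linarith

theorem leviCivita_add (hY : MDiffAt (T% Y) x) (hZ : MDiffAt (T% Z) x) :
    leviCivita I M (Y + Z) x = leviCivita I M Y x + leviCivita I M Z x :=
  (leviCivita I M).isCovariantDerivativeOnUniv.add hY hZ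

theorem leviCivita_smul {f : M → ℝ} (hf : MDiffAt f x) (hY : MDiffAt (T% Y) x)
    (u : TangentSpace I x) :
    leviCivita I M (f • Y) x u = f x • leviCivita I M Y x u + mvfderiv I f x u • Y x := by
  rw [(leviCivita I M).isCovariantDerivativeOnUniv.leibniz hY hf]
  rfl

theorem leviCivita_neg (hY : MDiffAt (T% Y) x) :
    leviCivita I M (-Y) x = - leviCivita I M Y x := by
  have := (leviCivita I M).isCovariantDerivativeOnUniv.smul_const (-1) hY
  simpa using this

theorem leviCivita_sub (hY : MDiffAt (T% Y) x) (hZ : MDiffAt (T% Z) x) :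
    leviCivita I M (Y - Z) x = leviCivita I M Y x - leviCivita I M Z x := by
  rw [sub_eq_add_neg, leviCivita_add hY (mdifferentiableAt_neg_section hZ), leviCivita_neg hZ,
    sub_eq_add_neg]

/-- Compatibility with the metric, for the derivative along a tangent vector. -/
theorem mvfderiv_inner (hY : MDiffAt (T% Y) x) (hZ : MDiffAt (T% Z) x) (u : TangentSpace I x) :
    mvfderiv I (fun y ↦ (inner ℝ (Y y) (Z y) : ℝ)) x u
      = inner ℝ (leviCivita I M Y x u) (Z x) + inner ℝ (Y x) (leviCivita I M Z x u) := by
  have := leviCivita_metric (mdifferentiableAt_extend_tangent u) hY hZ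
  simpa only [extend_apply_self] using this

/-! ### Symmetries of the curvature tensor -/

theorem mvfderiv_mvfderiv_inner (X : Π x : M, TangentSpace I x) (hY : CMDiff ∞ (T% Y))
    (hZ : CMDiff ∞ (T% Z)) (hW : CMDiff ∞ (T% W)) (x : M) :
    mvfderiv I (fun y ↦ mvfderiv I (fun z ↦ (inner ℝ (Z z) (W z) : ℝ)) y (Y y)) x (X x)
      = inner ℝ (leviCivita I M (fun y ↦ leviCivita I M Z y (Y y)) x (X x)) (W x)
        + inner ℝ (leviCivita I M Z x (Y x)) (leviCivita I M W x (X x))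
        + (inner ℝ (leviCivita I M Z x (X x)) (leviCivita I M W x (Y x))
        + inner ℝ (Z x) (leviCivita I M (fun y ↦ leviCivita I M W y (Y y)) x (X x))) := by
  have hYZ := (contMDiff_leviCivita hY hZ).mdifferentiableAt_section x
  have hYW := (contMDiff_leviCivita hY hW).mdifferentiableAt_section x
  have h : (fun y ↦ mvfderiv I (fun z ↦ (inner ℝ (Z z) (W z) : ℝ)) y (Y y))
      = fun y ↦ inner ℝ (leviCivita I M Z y (Y y)) (W y)
        + inner ℝ (Z y) (leviCivita I M W y (Y y)) :=
    funext fun y ↦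
      mvfderiv_inner (hZ.mdifferentiableAt_section y) (hW.mdifferentiableAt_section y) _
  rw [h, mvfderiv_fun_add (mdifferentiableAt_inner hYZ (hW.mdifferentiableAt_section x))
    (mdifferentiableAt_inner (hZ.mdifferentiableAt_section x) hYW), add_apply,
    mvfderiv_inner hYZ (hW.mdifferentiableAt_section x),
    mvfderiv_inner (hZ.mdifferentiableAt_section x) hYW]

/-- `R(X,Y)` is skew-symmetric. -/
theorem inner_curvatureField_left [T2Space M] (hX : CMDiff ∞ (T% X)) (hY : CMDiff ∞ (T% Y))
    (hZ : CMDiff ∞ (T% Z)) (hW : CMDiff ∞ (T% W)) (x : M) :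
    (inner ℝ (curvatureField X Y Z x) (W x) : ℝ) = - inner ℝ (Z x) (curvatureField X Y W x) := by
  have hZW : CMDiff ∞ (fun y ↦ (inner ℝ (Z y) (W y) : ℝ)) :=
    fun y ↦ contMDiffAt_inner (hZ y) (hW y)
  have h := mvfderiv_mlieBracket hZW hX hY x
  rw [mvfderiv_mvfderiv_inner X hY hZ hW, mvfderiv_mvfderiv_inner Y hX hZ hW,
    mvfderiv_inner (hZ.mdifferentiableAt_section x) (hW.mdifferentiableAt_section x)] at h
  simp only [curvatureField, inner_sub_left, inner_sub_right]
  linarith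

theorem curvatureField_swap (X Y Z : Π x : M, TangentSpace I x) (x : M) :
    curvatureField X Y Z x = - curvatureField Y X Z x := by
  simp only [curvatureField]
  rw [VectorField.mlieBracket_swap_apply, map_neg]
  abel

/-- The first Bianchi identity. -/
theorem curvatureField_bianchi (hX : CMDiff ∞ (T% X)) (hY : CMDiff ∞ (T% Y))
    (hZ : CMDiff ∞ (T% Z)) (x : M) :
    curvatureField X Y Z x + curvatureField Y Z X x + curvatureField Z X Y x = 0 := by
  have key {U V W : Π x : M, TangentSpace I x} (hU : CMDiff ∞ (T% U)) (hV : CMDiff ∞ (T% V))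
      (hW : CMDiff ∞ (T% W)) :
      leviCivita I M (fun y ↦ leviCivita I M W y (V y)) x (U x)
        - leviCivita I M (fun y ↦ leviCivita I M V y (W y)) x (U x)
        - leviCivita I M U x (VectorField.mlieBracket I V W x)
        = VectorField.mlieBracket I U (VectorField.mlieBracket I V W) x := by
    have h : (fun y ↦ leviCivita I M W y (V y)) - (fun y ↦ leviCivita I M V y (W y))
        = VectorField.mlieBracket I V W :=
      funext fun y ↦ leviCivita_torsion_free (hV.mdifferentiableAt_section y)
        (hW.mdifferentiableAt_section y)
    rw [← leviCivita_torsion_free (hU.mdifferentiableAt_section x)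
      ((contMDiff_mlieBracket hV hW).mdifferentiableAt_section x), ← h, leviCivita_sub
      ((contMDiff_leviCivita hV hW).mdifferentiableAt_section x)
      ((contMDiff_leviCivita hW hV).mdifferentiableAt_section x)]
    rfl
  have h1 := key hX hY hZ
  have h2 := key hY hZ hX
  have h3 := key hZ hX hY
  have h4 := mlieBracket_jacobi hX hY hZ x
  rw [VectorField.mlieBracket_swap (V := X) (W := Z)] at h4
  rw [VectorField.mlieBracket_swap_apply (V := VectorField.mlieBracket I X Y)] at h4
  have h5 : VectorField.mlieBracket I Y (-VectorField.mlieBracket I Z X) x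
      = - VectorField.mlieBracket I Y (VectorField.mlieBracket I Z X) x := by
    have := VectorField.mlieBracket_const_smul_right (V := Y) (c := (-1 : ℝ))
      ((contMDiff_mlieBracket hZ hX).mdifferentiableAt_section x)
    simpa using this
  rw [h5, ← h1, ← h2, ← h3, ← sub_eq_zero] at h4
  simp only [curvatureField]
  rw [← h4]
  abel

theorem leviCivita_congr (hY : MDiffAt (T% Y) x) (h : ∀ᶠ y in 𝓝 x, Z y = Y y) :
    leviCivita I M Z x = leviCivita I M Y x :=
  (leviCivita I M).isCovariantDerivativeOnUniv.congr_of_eventuallyEq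
    (hY.congr_of_eventuallyEq (h.mono fun y hy ↦ by simp [hy])) hY Filter.univ_mem h

theorem curvatureField_congr {X' Y' Z' : Π x : M, TangentSpace I x}
    (hX : CMDiff ∞ (T% X)) (hY : CMDiff ∞ (T% Y)) (hZ : CMDiff ∞ (T% Z))
    (hX' : ∀ᶠ y in 𝓝 x, X' y = X y) (hY' : ∀ᶠ y in 𝓝 x, Y' y = Y y)
    (hZ' : ∀ᶠ y in 𝓝 x, Z' y = Z y) : curvatureField X' Y' Z' x = curvatureField X Y Z x := by
  have key {U U' : Π x : M, TangentSpace I x} (hU : CMDiff ∞ (T% U))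
      (hU' : ∀ᶠ y in 𝓝 x, U' y = U y) :
      leviCivita I M (fun y ↦ leviCivita I M Z' y (U' y)) x
        = leviCivita I M (fun y ↦ leviCivita I M Z y (U y)) x := by
    refine leviCivita_congr ((contMDiff_leviCivita hU hZ).mdifferentiableAt_section x) ?_
    filter_upwards [hU', hZ'.eventually_nhds] with y hy hy'
    rw [hy, leviCivita_congr (hZ.mdifferentiableAt_section y) hy']
  simp only [curvatureField]
  rw [key hX hX', key hY hY', leviCivita_congr (hZ.mdifferentiableAt_section x) hZ',
    hX'.self_of_nhds, hY'.self_of_nhds, Filter.EventuallyEq.mlieBracket_vectorField_eq hX' hY']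

/-- The curvature tensor is tensorial in its last argument, because `R(X,Y)` is skew-symmetric. -/
theorem curvature_apply [T2Space M] {u v : TangentSpace I x}
    (hX : CMDiff ∞ (T% X)) (hXu : ∀ᶠ y in 𝓝 x, X y = extend E u y)
    (hY : CMDiff ∞ (T% Y)) (hYv : ∀ᶠ y in 𝓝 x, Y y = extend E v y) (hZ : CMDiff ∞ (T% Z)) :
    curvature x u v (Z x) = curvatureField X Y Z x := by
  obtain ⟨W, hW, hWx, hWe⟩ := exists_contMDiff_eventuallyEq_extend (Z x)
  have h1 : curvature x u v (Z x) = curvatureField X Y W x :=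
    curvatureField_congr hX hY hW (hXu.mono fun _ h ↦ h.symm) (hYv.mono fun _ h ↦ h.symm)
      (hWe.mono fun _ h ↦ h.symm)
  rw [h1]
  refine ext_inner_right ℝ fun z ↦ ?_
  obtain ⟨V, hV, rfl, -⟩ := exists_contMDiff_eventuallyEq_extend z
  rw [inner_curvatureField_left hX hY hW hV, inner_curvatureField_left hX hY hZ hV, hWx]

theorem curvature_swap (u v w : TangentSpace I x) :
    curvature x u v w = - curvature x v u w := curvatureField_swap _ _ _ _

theorem inner_curvature_left [T2Space M] (u v w z : TangentSpace I x) :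
    (inner ℝ (curvature x u v w) z : ℝ) = - inner ℝ w (curvature x u v z) := by
  obtain ⟨U, hU, -, hU'⟩ := exists_contMDiff_eventuallyEq_extend u
  obtain ⟨V, hV, -, hV'⟩ := exists_contMDiff_eventuallyEq_extend v
  obtain ⟨W, hW, rfl, -⟩ := exists_contMDiff_eventuallyEq_extend w
  obtain ⟨Z, hZ, rfl, -⟩ := exists_contMDiff_eventuallyEq_extend z
  rw [curvature_apply hU hU' hV hV' hW, curvature_apply hU hU' hV hV' hZ,
    inner_curvatureField_left hU hV hW hZ]

theorem curvature_smul_right [T2Space M] (c : ℝ) (u v w : TangentSpace I x) :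
    curvature x u v (c • w) = c • curvature x u v w := by
  refine ext_inner_right ℝ fun z ↦ ?_
  rw [inner_curvature_left, real_inner_smul_left, real_inner_smul_left, inner_curvature_left]
  ring

theorem curvature_zero_middle [T2Space M] (u w : TangentSpace I x) : curvature x u 0 w = 0 := by
  obtain ⟨U, hU, -, hU'⟩ := exists_contMDiff_eventuallyEq_extend u
  obtain ⟨W, hW, rfl, -⟩ := exists_contMDiff_eventuallyEq_extend w
  have h0 : ∀ᶠ y in 𝓝 x, (0 : Π y : M, TangentSpace I y) y = extend E (0 : TangentSpace I x) y := by
    filter_upwards [(trivializationAt E (TangentSpace I : M → Type _) x).open_baseSet.mem_nhds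
      (mem_baseSet_trivializationAt' x)] with y hy
    have h := (trivializationAt E (TangentSpace I : M → Type _) x).coe_linearMapAt_of_mem (R := ℝ)
      (mem_baseSet_trivializationAt' x)
    rw [extend, ← congrFun h 0, map_zero, ← Trivialization.coe_symmₗ (R := ℝ) _ hy, map_zero]
    rfl
  rw [curvature_apply (Y := 0) hU hU' (contMDiff_zeroSection ℝ (TangentSpace I : M → Type _)) h0
    hW, curvatureField]
  have h1 : (fun y ↦ leviCivita I M W y ((0 : Π y : M, TangentSpace I y) y)) = 0 :=
    funext fun y ↦ map_zero _
  rw [h1, (leviCivita I M).zero]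
  simp

/-- The first Bianchi identity at a point. -/
theorem curvature_bianchi [T2Space M] (u v w : TangentSpace I x) :
    curvature x u v w + curvature x v w u + curvature x w u v = 0 := by
  obtain ⟨U, hU, rfl, hU'⟩ := exists_contMDiff_eventuallyEq_extend u
  obtain ⟨V, hV, rfl, hV'⟩ := exists_contMDiff_eventuallyEq_extend v
  obtain ⟨W, hW, rfl, hW'⟩ := exists_contMDiff_eventuallyEq_extend w
  rw [curvature_apply hU hU' hV hV' hW, curvature_apply hV hV' hW hW' hU,
    curvature_apply hW hW' hU hU' hV, curvatureField_bianchi hU hV hW]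

/-! ### Traces in an orthonormal frame -/

theorem sum_inner_frame_sq (v : TangentSpace I x) :
    ∑ i, (inner ℝ (frame x i) v : ℝ) ^ 2 = inner ℝ v v := by
  rw [← (frame x).sum_inner_mul_inner v v]
  refine Finset.sum_congr rfl fun i _ ↦ ?_
  rw [real_inner_comm (frame x i) v, sq]

theorem inner_frame_self (i : Fin (Module.finrank ℝ (TangentSpace I x))) :
    (inner ℝ (frame x i) (frame x i) : ℝ) = 1 := by
  rw [real_inner_self_eq_norm_sq, (frame x).norm_eq_one, one_pow]

theorem sum_frame_const (c : ℝ) :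
    ∑ _i : Fin (Module.finrank ℝ (TangentSpace I x)), c = Module.finrank ℝ E * c := by
  rw [Finset.sum_const, Finset.card_univ, Fintype.card_fin, nsmul_eq_mul]
  rfl

theorem ricci_smul_right [T2Space M] (c : ℝ) (v w : TangentSpace I x) :
    ricci x v (c • w) = c * ricci x v w := by
  simp only [ricci, traceAt, curvature_smul_right, real_inner_smul_left, Finset.mul_sum]

namespace AlmostContactMetric

/-! ### Differentiability of the structure tensors -/

variable (A : AlmostContactMetric I M)

theorem contMDiff_phi_apply (hX : CMDiff ∞ (T% X)) : CMDiff ∞ (T% (fun y ↦ A.phi y (X y))) :=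
  ContMDiff.clm_bundle_apply (E₁ := fun x : M ↦ TangentSpace I x)
    (E₂ := fun x : M ↦ TangentSpace I x) A.contMDiff_phi hX

theorem mdifferentiableAt_phi_apply (hX : MDiffAt (T% X) x) :
    MDiffAt (T% (fun y ↦ A.phi y (X y))) x :=
  MDifferentiableAt.clm_bundle_apply (E₁ := fun x : M ↦ TangentSpace I x)
    (E₂ := fun x : M ↦ TangentSpace I x)
    ((A.contMDiff_phi x).mdifferentiableAt (by simp)) hX

theorem mdifferentiableAt_xi (x : M) : MDiffAt (T% A.xi) x :=
  (A.contMDiff_xi x).mdifferentiableAt (by simp)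

theorem mvfderiv_eta (hX : MDiffAt (T% X) x) (u : TangentSpace I x) :
    mvfderiv I (fun y ↦ A.eta y (X y)) x u
      = A.eta x (leviCivita I M X x u) + inner ℝ (X x) (leviCivita I M A.xi x u) := by
  simp_rw [← A.inner_xi]
  exact mvfderiv_inner hX (A.mdifferentiableAt_xi x) u

theorem inner_xi_xi (x : M) : (inner ℝ (A.xi x) (A.xi x) : ℝ) = 1 := by
  rw [A.inner_xi, A.eta_xi]

/-! ### The covariant derivatives of `φ` and `ξ` -/

/-- The covariant derivative `(∇_u φ) Y = ∇_u (φ Y) - φ (∇_u Y)` of `φ`. -/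
noncomputable def nablaPhi (Y : Π x : M, TangentSpace I x) (x : M)
    (u : TangentSpace I x) : TangentSpace I x :=
  leviCivita I M (fun y ↦ A.phi y (Y y)) x u - A.phi x (leviCivita I M Y x u)

theorem inner_nablaPhi_left (hY : MDiffAt (T% Y) x) (hZ : MDiffAt (T% Z) x)
    (u : TangentSpace I x) :
    (inner ℝ (A.nablaPhi Y x u) (Z x) : ℝ) = - inner ℝ (Y x) (A.nablaPhi Z x u) := by
  have h1 := mvfderiv_inner (A.mdifferentiableAt_phi_apply hY) hZ u
  have h2 := mvfderiv_inner hY (A.mdifferentiableAt_phi_apply hZ) u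
  have h3 : (fun y ↦ (inner ℝ (Y y) (A.phi y (Z y)) : ℝ))
      = - fun y ↦ inner ℝ (A.phi y (Y y)) (Z y) := funext fun y ↦ A.inner_phi y _ _
  rw [h3, mvfderiv_neg, neg_apply] at h2
  have h4 := A.inner_phi x (leviCivita I M Y x u) (Z x)
  have h5 := A.inner_phi x (Y x) (leviCivita I M Z x u)
  simp only [nablaPhi, inner_sub_left, inner_sub_right]
  linarith

/-- `(∇_u φ) Y` depends only on the value of `Y` at the point, because `∇_u φ` is
skew-symmetric. -/
theorem nablaPhi_congr (hY : MDiffAt (T% Y) x) (hZ : MDiffAt (T% Z) x) (h : Y x = Z x)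
    (u : TangentSpace I x) : A.nablaPhi Y x u = A.nablaPhi Z x u := by
  refine ext_inner_right ℝ fun w ↦ ?_
  have hw := mdifferentiableAt_extend_tangent w
  have h1 := A.inner_nablaPhi_left hY hw u
  have h2 := A.inner_nablaPhi_left hZ hw u
  rw [extend_apply_self] at h1 h2
  rw [h1, h2, h]

theorem inner_leviCivita_xi_xi (u : TangentSpace I x) :
    (inner ℝ (leviCivita I M A.xi x u) (A.xi x) : ℝ) = 0 := by
  have h := mvfderiv_inner (A.mdifferentiableAt_xi x) (A.mdifferentiableAt_xi x) u
  simp_rw [A.inner_xi_xi, mvfderiv_const] at h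
  rw [real_inner_comm (leviCivita I M A.xi x u) (A.xi x)] at h
  simp only [zero_apply] at h
  linarith

theorem nablaPhi_xi (u : TangentSpace I x) :
    A.nablaPhi A.xi x u = - A.phi x (leviCivita I M A.xi x u) := by
  have h : (fun y ↦ A.phi y (A.xi y)) = 0 := funext A.phi_xi
  rw [nablaPhi, h, (leviCivita I M).isCovariantDerivativeOnUniv.zero]
  simp

/-- The derivative of `φ² = - id + η ⊗ ξ`. -/
theorem phi_nablaPhi_add (hY : MDiffAt (T% Y) x) (u : TangentSpace I x) :
    A.phi x (A.nablaPhi Y x u) + A.nablaPhi (fun y ↦ A.phi y (Y y)) x u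
      = (inner ℝ (leviCivita I M A.xi x u) (Y x) : ℝ) • A.xi x
        + (inner ℝ (Y x) (A.xi x) : ℝ) • leviCivita I M A.xi x u := by
  have hξ := A.mdifferentiableAt_xi x
  have h : (fun y ↦ A.phi y (A.phi y (Y y)))
      = - Y + (fun y ↦ (inner ℝ (Y y) (A.xi y) : ℝ)) • A.xi := by
    funext y
    simp only [A.phi_phi, Pi.add_apply, Pi.neg_apply, Pi.smul_apply', A.inner_xi]
  simp only [nablaPhi]
  rw [h, leviCivita_add (mdifferentiableAt_neg_section hY)
    ((mdifferentiableAt_inner hY hξ).smul_section hξ), leviCivita_neg hY, add_apply, neg_apply,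
    leviCivita_smul (mdifferentiableAt_inner hY hξ) hξ, mvfderiv_inner hY hξ, map_sub, A.phi_phi,
    A.inner_xi x (leviCivita I M Y x u),
    real_inner_comm (leviCivita I M A.xi x u) (Y x)]
  module

variable {A}

/-- The contact condition, in terms of `∇ ξ`. -/
theorem IsContactMetric.inner_leviCivita_xi_sub (hA : A.IsContactMetric) (u v : TangentSpace I x) :
    (inner ℝ (leviCivita I M A.xi x u) v : ℝ) - inner ℝ (leviCivita I M A.xi x v) u
      = 2 * inner ℝ u (A.phi x v) := by
  have hu := mdifferentiableAt_extend_tangent u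
  have hv := mdifferentiableAt_extend_tangent v
  have h := hA _ _ x hu hv
  rw [dEta, ← leviCivita_torsion_free hu hv, A.mvfderiv_eta hu, A.mvfderiv_eta hv, map_sub] at h
  simp only [extend_apply_self] at h
  rw [real_inner_comm (leviCivita I M A.xi x u) v, real_inner_comm (leviCivita I M A.xi x v) u] at h
  linarith

/-- The normality condition, in terms of `∇ φ`. -/
theorem IsSasakian.nablaPhi_normal (hA : A.IsSasakian) (hX : MDiffAt (T% X) x)
    (hY : MDiffAt (T% Y) x) :
    A.nablaPhi Y x (A.phi x (X x)) - A.nablaPhi X x (A.phi x (Y x))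
      + A.phi x (A.nablaPhi X x (Y x)) - A.phi x (A.nablaPhi Y x (X x))
      = - (2 * inner ℝ (X x) (A.phi x (Y x)) : ℝ) • A.xi x := by
  have hφX := A.mdifferentiableAt_phi_apply hX
  have hφY := A.mdifferentiableAt_phi_apply hY
  have h := hA.2 X Y x hX hY
  rw [hA.1 X Y x hX hY, nijenhuis, ← leviCivita_torsion_free hX hY,
    ← leviCivita_torsion_free hφX hφY, ← leviCivita_torsion_free hφX hY,
    ← leviCivita_torsion_free hX hφY] at h
  simp only [map_sub] at h
  rw [neg_smul, eq_neg_iff_add_eq_zero, ← h]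
  simp only [nablaPhi, map_sub]
  abel

/-- The derivative of the contact condition along a vector field. -/
theorem IsContactMetric.two_mul_inner_nablaPhi (hA : A.IsContactMetric) (hX : CMDiff ∞ (T% X))
    (hY : CMDiff ∞ (T% Y)) (x : M) (u : TangentSpace I x) :
    2 * (inner ℝ (X x) (A.nablaPhi Y x u) : ℝ)
      = inner ℝ (leviCivita I M (fun y ↦ leviCivita I M A.xi y (X y)) x u) (Y x)
        - inner ℝ (leviCivita I M A.xi x (leviCivita I M X x u)) (Y x)
        - (inner ℝ (leviCivita I M (fun y ↦ leviCivita I M A.xi y (Y y)) x u) (X x)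
        - inner ℝ (leviCivita I M A.xi x (leviCivita I M Y x u)) (X x)) := by
  have hX' := hX.mdifferentiableAt_section x
  have hY' := hY.mdifferentiableAt_section x
  have hξX := (contMDiff_leviCivita hX A.contMDiff_xi).mdifferentiableAt_section x
  have hξY := (contMDiff_leviCivita hY A.contMDiff_xi).mdifferentiableAt_section x
  have h : (fun y ↦ (inner ℝ (leviCivita I M A.xi y (X y)) (Y y) : ℝ))
      - (fun y ↦ inner ℝ (leviCivita I M A.xi y (Y y)) (X y))
      = (fun y ↦ inner ℝ (X y) (A.phi y (Y y))) + fun y ↦ inner ℝ (X y) (A.phi y (Y y)) := by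
    funext y
    have := hA.inner_leviCivita_xi_sub (X y) (Y y)
    simp only [Pi.sub_apply, Pi.add_apply]
    linarith
  have h' := congrArg (fun f ↦ mvfderiv I f x u) h
  have hXφ := mdifferentiableAt_inner hX' (A.mdifferentiableAt_phi_apply hY')
  simp only [mvfderiv_sub (mdifferentiableAt_inner hξX hY') (mdifferentiableAt_inner hξY hX'),
    mvfderiv_add hXφ hXφ, sub_apply, add_apply, mvfderiv_inner hξX hY', mvfderiv_inner hξY hX',
    mvfderiv_inner hX' (A.mdifferentiableAt_phi_apply hY')] at h'
  have h1 := hA.inner_leviCivita_xi_sub (leviCivita I M X x u) (Y x)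
  have h2 := hA.inner_leviCivita_xi_sub (X x) (leviCivita I M Y x u)
  simp only [nablaPhi, inner_sub_right]
  linarith

/-- The fundamental `2`-form `Φ = dη` is closed. -/
theorem IsContactMetric.cyclic_nablaPhi [T2Space M] (hA : A.IsContactMetric)
    (hX : CMDiff ∞ (T% X)) (hY : CMDiff ∞ (T% Y)) (hZ : CMDiff ∞ (T% Z)) (x : M) :
    (inner ℝ (A.nablaPhi Y x (X x)) (Z x) : ℝ) + inner ℝ (A.nablaPhi Z x (Y x)) (X x)
      + inner ℝ (A.nablaPhi X x (Z x)) (Y x) = 0 := by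
  have h1 := hA.two_mul_inner_nablaPhi hZ hY x (X x)
  have h2 := hA.two_mul_inner_nablaPhi hX hZ x (Y x)
  have h3 := hA.two_mul_inner_nablaPhi hY hX x (Z x)
  have hb := congrArg (fun v ↦ (inner ℝ (A.xi x) v : ℝ)) (curvatureField_bianchi hX hY hZ x)
  simp only [inner_add_right, inner_zero_right] at hb
  have c1 := inner_curvatureField_left hX hY A.contMDiff_xi hZ x
  have c2 := inner_curvatureField_left hY hZ A.contMDiff_xi hX x
  have c3 := inner_curvatureField_left hZ hX A.contMDiff_xi hY x
  rw [curvatureField, ← leviCivita_torsion_free (hX.mdifferentiableAt_section x)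
    (hY.mdifferentiableAt_section x)] at c1
  rw [curvatureField, ← leviCivita_torsion_free (hY.mdifferentiableAt_section x)
    (hZ.mdifferentiableAt_section x)] at c2
  rw [curvatureField, ← leviCivita_torsion_free (hZ.mdifferentiableAt_section x)
    (hX.mdifferentiableAt_section x)] at c3
  simp only [inner_sub_left, map_sub] at c1 c2 c3
  rw [real_inner_comm (Z x), real_inner_comm (X x), real_inner_comm (Y x)]
  linarith

/-- `∇ ξ` and `∇ φ` on a Sasakian manifold: the pointwise algebra, applied to the bilinear map
`(u, v) ↦ (∇_u φ) v`, with `v` extended to a vector field. -/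
theorem IsSasakian.leviCivita_xi_and_nablaPhi [T2Space M] (hA : A.IsSasakian) (x : M) :
    (∀ u : TangentSpace I x, leviCivita I M A.xi x u = - A.phi x u) ∧
      ∀ u v : TangentSpace I x, A.nablaPhi (extend E v) x u
        = (inner ℝ u v : ℝ) • A.xi x - (inner ℝ v (A.xi x) : ℝ) • u := by
  have hξ := A.mdifferentiableAt_xi x
  have hex (v : TangentSpace I x) := mdifferentiableAt_extend_tangent v
  refine eq_neg_and_eq_of_contact_of_normal
    (φ := (A.phi x : TangentSpace I x →ₗ[ℝ] TangentSpace I x))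
    (ξ := A.xi x) (F := fun u v ↦ A.nablaPhi (extend E v) x u)
    (A := (leviCivita I M A.xi x : TangentSpace I x →ₗ[ℝ] TangentSpace I x))
    (A.inner_xi_xi x) (fun u ↦ ?_) (A.phi_xi x) (A.inner_phi x) (fun u v w ↦ ?_) (fun v ↦ ?_)
    (fun u ↦ ?_) A.inner_leviCivita_xi_xi (fun u v ↦ ?_) hA.1.inner_leviCivita_xi_sub
    (fun u v ↦ ?_) (fun u v w ↦ ?_)
  · rw [A.inner_xi]; exact A.phi_phi x u
  · simpa using A.inner_nablaPhi_left (hex v) (hex w) u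
  · simp [nablaPhi]
  · exact (A.nablaPhi_congr (hex _) hξ (by simp) u).trans (A.nablaPhi_xi u)
  · have h := A.phi_nablaPhi_add (hex v) u
    rw [A.nablaPhi_congr (A.mdifferentiableAt_phi_apply (hex v)) (hex (A.phi x v)) (by simp)] at h
    simpa using h
  · simpa using hA.nablaPhi_normal (hex u) (hex v)
  · obtain ⟨U, hU, rfl, -⟩ := exists_contMDiff_eventuallyEq_extend u
    obtain ⟨V, hV, rfl, -⟩ := exists_contMDiff_eventuallyEq_extend v
    obtain ⟨W, hW, rfl, -⟩ := exists_contMDiff_eventuallyEq_extend w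
    have h := hA.1.cyclic_nablaPhi hU hV hW x
    have e {V : Π x : M, TangentSpace I x} (hV : CMDiff ∞ (T% V)) (u) :
        A.nablaPhi V x u = A.nablaPhi (extend E (V x)) x u :=
      A.nablaPhi_congr (hV.mdifferentiableAt_section x) (hex _) (by simp) u
    rwa [e hU, e hV, e hW] at h

/-- On a Sasakian manifold, `∇_u ξ = - φ u`. -/
theorem IsSasakian.leviCivita_xi [T2Space M] (hA : A.IsSasakian) (u : TangentSpace I x) :
    leviCivita I M A.xi x u = - A.phi x u :=
  (hA.leviCivita_xi_and_nablaPhi x).1 u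

/-- On a Sasakian manifold, `(∇_u φ) Y = g(u,Y) ξ - η(Y) u`. -/
theorem IsSasakian.leviCivita_phi [T2Space M] (hA : A.IsSasakian) (hY : MDiffAt (T% Y) x)
    (u : TangentSpace I x) :
    leviCivita I M (fun y ↦ A.phi y (Y y)) x u
      = A.phi x (leviCivita I M Y x u) + (inner ℝ u (Y x) : ℝ) • A.xi x
        - (inner ℝ (Y x) (A.xi x) : ℝ) • u := by
  have h := (hA.leviCivita_xi_and_nablaPhi x).2 u (Y x)
  rw [A.nablaPhi_congr (mdifferentiableAt_extend_tangent _) hY (by simp), nablaPhi,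
    sub_eq_iff_eq_add] at h
  rw [h]
  abel

/-! ### The curvature of a Sasakian manifold -/

theorem IsSasakian.curvature_xi [T2Space M] (hA : A.IsSasakian) (u v : TangentSpace I x) :
    curvature x u v (A.xi x) = A.eta x v • u - A.eta x u • v := by
  obtain ⟨U, hU, rfl, hU'⟩ := exists_contMDiff_eventuallyEq_extend u
  obtain ⟨V, hV, rfl, hV'⟩ := exists_contMDiff_eventuallyEq_extend v
  rw [curvature_apply hU hU' hV hV' A.contMDiff_xi]
  have key {W : Π x : M, TangentSpace I x} (hW : CMDiff ∞ (T% W)) (u : TangentSpace I x) :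
      leviCivita I M (fun y ↦ leviCivita I M A.xi y (W y)) x u
        = - (A.phi x (leviCivita I M W x u) + (inner ℝ u (W x) : ℝ) • A.xi x
          - (inner ℝ (W x) (A.xi x) : ℝ) • u) := by
    have h : (fun y ↦ leviCivita I M A.xi y (W y)) = - fun y ↦ A.phi y (W y) :=
      funext fun y ↦ hA.leviCivita_xi (W y)
    rw [h, leviCivita_neg ((A.contMDiff_phi_apply hW).mdifferentiableAt_section x), neg_apply,
      hA.leviCivita_phi (hW.mdifferentiableAt_section x)]
  rw [curvatureField, key hU, key hV, hA.leviCivita_xi, ← leviCivita_torsion_free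
    (hU.mdifferentiableAt_section x) (hV.mdifferentiableAt_section x), map_sub,
    real_inner_comm (U x) (V x)]
  simp only [A.inner_xi]
  module

/-- The commutator of `R(u,v)` with `φ`. -/
theorem IsSasakian.curvature_phi [T2Space M] (hA : A.IsSasakian) (u v w : TangentSpace I x) :
    curvature x u v (A.phi x w) = A.phi x (curvature x u v w)
      - (inner ℝ v w : ℝ) • A.phi x u + (inner ℝ u w : ℝ) • A.phi x v
      + (inner ℝ (A.phi x u) w : ℝ) • v - (inner ℝ (A.phi x v) w : ℝ) • u := by
  obtain ⟨U, hU, rfl, hU'⟩ := exists_contMDiff_eventuallyEq_extend u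
  obtain ⟨V, hV, rfl, hV'⟩ := exists_contMDiff_eventuallyEq_extend v
  obtain ⟨W, hW, rfl, -⟩ := exists_contMDiff_eventuallyEq_extend w
  have hW' := hW.mdifferentiableAt_section x
  have hξ := A.mdifferentiableAt_xi x
  rw [curvature_apply hU hU' hV hV' (A.contMDiff_phi_apply hW), curvature_apply hU hU' hV hV' hW]
  have key {Y : Π x : M, TangentSpace I x} (hY : CMDiff ∞ (T% Y)) (u : TangentSpace I x) :
      leviCivita I M (fun y ↦ leviCivita I M (fun z ↦ A.phi z (W z)) y (Y y)) x u
        = A.phi x (leviCivita I M (fun y ↦ leviCivita I M W y (Y y)) x u)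
          + (inner ℝ u (leviCivita I M W x (Y x)) : ℝ) • A.xi x
          - (inner ℝ (leviCivita I M W x (Y x)) (A.xi x) : ℝ) • u
          + ((inner ℝ (Y x) (W x) : ℝ) • (- A.phi x u)
            + ((inner ℝ (leviCivita I M Y x u) (W x) : ℝ)
              + inner ℝ (Y x) (leviCivita I M W x u)) • A.xi x)
          - ((inner ℝ (W x) (A.xi x) : ℝ) • leviCivita I M Y x u
            + ((inner ℝ (leviCivita I M W x u) (A.xi x) : ℝ)
              + inner ℝ (W x) (- A.phi x u)) • Y x) := by
    have hY' := hY.mdifferentiableAt_section x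
    have hYW := contMDiff_leviCivita hY hW
    have hYW' := hYW.mdifferentiableAt_section x
    have h : (fun y ↦ leviCivita I M (fun z ↦ A.phi z (W z)) y (Y y))
        = (fun y ↦ A.phi y (leviCivita I M W y (Y y)))
          + (fun y ↦ (inner ℝ (Y y) (W y) : ℝ)) • A.xi
          - (fun y ↦ (inner ℝ (W y) (A.xi y) : ℝ)) • Y :=
      funext fun y ↦ hA.leviCivita_phi (hW.mdifferentiableAt_section y) (Y y)
    have s1 := A.mdifferentiableAt_phi_apply hYW'
    have s2 := (mdifferentiableAt_inner hY' hW').smul_section hξ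
    have s3 := (mdifferentiableAt_inner hW' hξ).smul_section hY'
    rw [h, leviCivita_sub (mdifferentiableAt_add_section s1 s2) s3, leviCivita_add s1 s2,
      sub_apply, add_apply, leviCivita_smul (mdifferentiableAt_inner hY' hW') hξ,
      leviCivita_smul (mdifferentiableAt_inner hW' hξ) hY', mvfderiv_inner hY' hW',
      mvfderiv_inner hW' hξ, hA.leviCivita_phi hYW', hA.leviCivita_xi]
  simp only [curvatureField]
  rw [key hU, key hV, hA.leviCivita_phi hW', ← leviCivita_torsion_free
    (hU.mdifferentiableAt_section x) (hV.mdifferentiableAt_section x)]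
  simp only [map_sub, inner_sub_left, inner_neg_right]
  rw [real_inner_comm (W x) (A.phi x (U x)), real_inner_comm (W x) (A.phi x (V x))]
  module

theorem IsSasakian.ricci_xi [T2Space M] (hA : A.IsSasakian) (v : TangentSpace I x) :
    ricci x v (A.xi x) = (Module.finrank ℝ E - 1) * A.eta x v := by
  have h (i) : (inner ℝ (curvature x (frame x i) v (A.xi x)) (frame x i) : ℝ)
      = A.eta x v - inner ℝ v (frame x i) * inner ℝ (frame x i) (A.xi x) := by
    rw [hA.curvature_xi, inner_sub_left, real_inner_smul_left, real_inner_smul_left,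
      inner_frame_self, A.inner_xi]
    ring
  simp only [ricci, traceAt, h]
  rw [Finset.sum_sub_distrib, (frame x).sum_inner_mul_inner, sum_frame_const, A.inner_xi]
  ring

/-- The vector field `ξ` of a Sasakian manifold is a Killing field. -/
theorem IsSasakian.lieDerivMetric_xi [T2Space M] (hA : A.IsSasakian) (hX : MDiffAt (T% X) x)
    (hY : MDiffAt (T% Y) x) : lieDerivMetric A.xi X Y x = 0 := by
  have hξ := A.mdifferentiableAt_xi x
  rw [lieDerivMetric, mvfderiv_inner hX hY, ← leviCivita_torsion_free hξ hX,
    ← leviCivita_torsion_free hξ hY, hA.leviCivita_xi, hA.leviCivita_xi, inner_sub_left,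
    inner_sub_right, inner_neg_left, inner_neg_right, A.inner_phi]
  ring

theorem starRicci_xi_xi [T2Space M] : A.starRicci x (A.xi x) (A.xi x) = 0 := by
  have h (u : TangentSpace I x) : curvature x (A.xi x) (A.phi x (A.xi x)) u = 0 := by
    rw [A.phi_xi, curvature_zero_middle]
  simp [starRicci, traceAt, h]

/-- The relation between the `*`-Ricci tensor and the Ricci tensor: by the first Bianchi identity,
`R(v,φv)` is the difference of `R(e,φv)v` and `R(e,v)φv`, and `φ` is moved through `R`. -/
theorem IsSasakian.starRicci_self [T2Space M] (hA : A.IsSasakian) {v : TangentSpace I x}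
    (hv : (inner ℝ v v : ℝ) = 1) (hη : A.eta x v = 0) :
    A.starRicci x v v = 1 / 2 * (ricci x v v + ricci x (A.phi x v) (A.phi x v))
      - (Module.finrank ℝ E - 2) := by
  have hφφ : A.phi x (A.phi x v) = - v := by rw [A.phi_phi, hη, zero_smul, add_zero]
  have hφv : (inner ℝ (A.phi x v) (A.phi x v) : ℝ) = 1 := by
    rw [A.inner_phi_phi, hη, hv]; ring
  have hvφ : (inner ℝ (A.phi x v) v : ℝ) = 0 := by
    have := A.inner_phi x v v
    rw [real_inner_comm (A.phi x v) v] at this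
    linarith
  have key (e : TangentSpace I x) (he : (inner ℝ e e : ℝ) = 1) :
      (inner ℝ (A.phi x (curvature x v (A.phi x v) e)) e : ℝ)
        = inner ℝ (curvature x e v v) e
          + inner ℝ (curvature x e (A.phi x v) (A.phi x v)) e
          - 2 + 2 * inner ℝ e v ^ 2 + 2 * inner ℝ e (A.phi x v) ^ 2 := by
    have h1 := congrArg (fun z ↦ (inner ℝ z (A.phi x e) : ℝ)) (curvature_bianchi v (A.phi x v) e)
    simp only [inner_add_left, inner_zero_left] at h1
    have h2 := A.inner_phi x (curvature x v (A.phi x v) e) e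
    -- The commutator of `R(e,v)` with `φ` expresses `g(R(e,v) φv, φe)` through `g(R(e,v) v, e)`.
    have h3 := congrArg (fun z ↦ (inner ℝ z (A.phi x e) : ℝ)) (hA.curvature_phi e v v)
    simp only [inner_add_left, inner_sub_left, real_inner_smul_left, A.inner_phi_phi, hη, hv,
      hvφ, he] at h3
    have h4 := A.inner_phi x v e
    have h5 := A.inner_phi x e v
    have h6 : A.eta x (curvature x e v v) = A.eta x e := by
      rw [← A.inner_xi, inner_curvature_left, hA.curvature_xi, hη, zero_smul, zero_sub,
        inner_neg_right, real_inner_smul_right, hv]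
      ring
    rw [h6] at h3
    -- The commutator of `R(φv,e)` with `φ` expresses `g(R(φv,e) v, φe)` through
    -- `g(R(e,φv) φv, e)`.
    have h7 := congrArg (fun z ↦ (inner ℝ z e : ℝ)) (hA.curvature_phi (A.phi x v) e v)
    simp only [inner_add_left, inner_sub_left, real_inner_smul_left, hφφ, hvφ, he,
      inner_neg_left, hv] at h7
    have h8 := A.inner_phi x (curvature x (A.phi x v) e v) e
    rw [curvature_swap (A.phi x v) e (A.phi x v), inner_neg_left] at h7
    have h9 : (inner ℝ (A.phi x e) v : ℝ) = - inner ℝ e (A.phi x v) := by linarith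
    rw [h4, h9, real_inner_comm e v, real_inner_comm e (A.phi x v)] at h3
    rw [h9, real_inner_comm e v, real_inner_comm e (A.phi x v)] at h7
    linarith
  have hsum : traceAt x (fun u ↦ A.phi x (curvature x v (A.phi x v) u))
      = ricci x v v + ricci x (A.phi x v) (A.phi x v) - Module.finrank ℝ E * 2
        + 2 * ∑ i, (inner ℝ (frame x i) v : ℝ) ^ 2
        + 2 * ∑ i, (inner ℝ (frame x i) (A.phi x v) : ℝ) ^ 2 := by
    rw [← sum_frame_const (I := I) (x := x)]
    simp only [traceAt, ricci, Finset.mul_sum]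
    rw [← Finset.sum_add_distrib, ← Finset.sum_sub_distrib, ← Finset.sum_add_distrib,
      ← Finset.sum_add_distrib]
    exact Finset.sum_congr rfl fun i _ ↦ key _ (inner_frame_self i)
  rw [starRicci, hsum, sum_inner_frame_sq, sum_inner_frame_sq, hv, hφv]
  ring

/-! ### Solitons -/

/-- The soliton equation on `(ξ, ξ)`. -/
theorem IsStarConformalEtaRicciSoliton.xi_xi [T2Space M] {lam mu : ℝ} {p : M → ℝ}
    (hsol : A.IsStarConformalEtaRicciSoliton lam mu p) (hA : A.IsSasakian) (x : M) :
    2 * lam - (p x + 2 / Module.finrank ℝ E) + 2 * mu = 0 := by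
  have hξ := A.mdifferentiableAt_xi x
  have h := hsol _ _ x hξ hξ
  rw [hA.lieDerivMetric_xi hξ hξ, starRicci_xi_xi, A.inner_xi_xi, A.eta_xi] at h
  linarith

/-- The soliton equation on a unit vector orthogonal to `ξ`. -/
theorem IsStarConformalEtaRicciSoliton.ricci_add_ricci [T2Space M] {lam mu : ℝ} {p : M → ℝ}
    (hsol : A.IsStarConformalEtaRicciSoliton lam mu p) (hA : A.IsSasakian) {v : TangentSpace I x}
    (hv : (inner ℝ v v : ℝ) = 1) (hη : A.eta x v = 0) :
    ricci x v v + ricci x (A.phi x v) (A.phi x v) = 2 * (mu + Module.finrank ℝ E - 2) := by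
  have hev := mdifferentiableAt_extend_tangent v
  have h := hsol _ _ x hev hev
  rw [hA.lieDerivMetric_xi hev hev] at h
  simp only [extend_apply_self] at h
  rw [hA.starRicci_self hv hη, hv, hη] at h
  linarith [hsol.xi_xi hA x]

/-- The condition `P(ξ,v) · S = 0`, evaluated on `(v, ξ)` for a unit vector `v` orthogonal
to `ξ`. -/
theorem IsSasakian.mul_ricci_sub_eq_zero [T2Space M] (hA : A.IsSasakian) {a b : ℝ}
    (hP : ∀ u v w : TangentSpace I x,
      derivationAction (pseudoProjective a b x (A.xi x) u) (ricci x) v w = 0)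
    {v : TangentSpace I x} (hv : (inner ℝ v v : ℝ) = 1) (hη : A.eta x v = 0) :
    (a - scalarCurvature I x / Module.finrank ℝ E * (a / (Module.finrank ℝ E - 1) + b))
      * (Module.finrank ℝ E - 1 - ricci x v v) = 0 := by
  have h := hP v v (A.xi x)
  have h1 : A.eta x (curvature x (A.xi x) v v) = 1 := by
    rw [← A.inner_xi, inner_curvature_left, hA.curvature_xi, hη, A.eta_xi, zero_smul,
      one_smul, zero_sub, inner_neg_right, neg_neg, hv]
  have h2 : (inner ℝ (A.xi x) v : ℝ) = 0 := by rw [real_inner_comm, A.inner_xi, hη]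
  set k := scalarCurvature I x / Module.finrank ℝ E * (a / (Module.finrank ℝ E - 1) + b) with hk
  have h3 : pseudoProjective a b x (A.xi x) v (A.xi x)
      = (k - a - b * (Module.finrank ℝ E - 1)) • v := by
    rw [pseudoProjective, ← hk, hA.curvature_xi, hA.ricci_xi, hA.ricci_xi, A.inner_xi, A.inner_xi,
      hη, A.eta_xi]
    module
  rw [derivationAction, h3, ricci_smul_right, hA.ricci_xi, pseudoProjective, ← hk, hv, h2] at h
  simp only [map_sub, map_add, map_smul, smul_eq_mul, h1, hη, A.eta_xi] at h
  linarith

theorem exists_unit_eta_eq_zero (A : AlmostContactMetric I M) (hE : 1 < Module.finrank ℝ E)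
    (x : M) : ∃ v : TangentSpace I x, (inner ℝ v v : ℝ) = 1 ∧ A.eta x v = 0 := by
  have hrk : Module.finrank ℝ (LinearMap.range (A.eta x : TangentSpace I x →ₗ[ℝ] ℝ)) ≤ 1 :=
    (Submodule.finrank_le _).trans (Module.finrank_self ℝ).le
  have hsum := (A.eta x : TangentSpace I x →ₗ[ℝ] ℝ).finrank_range_add_finrank_ker
  have hT : Module.finrank ℝ (TangentSpace I x) = Module.finrank ℝ E := rfl
  have hker : 0 < Module.finrank ℝ (LinearMap.ker (A.eta x : TangentSpace I x →ₗ[ℝ] ℝ)) := by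
    omega
  obtain ⟨⟨w, hw⟩, hw0⟩ := Module.finrank_pos_iff_exists_ne_zero.mp hker
  have hw0' : ‖w‖ ≠ 0 := norm_ne_zero_iff.mpr fun h ↦ hw0 (Subtype.ext h)
  refine ⟨‖w‖⁻¹ • w, ?_, ?_⟩
  · rw [real_inner_smul_left, real_inner_smul_right, real_inner_self_eq_norm_sq]
    field_simp
  · have hw' : A.eta x w = 0 := hw
    rw [map_smul, hw', smul_zero]

/-- On a Sasakian manifold with a `*`-conformal `η`-Ricci soliton and `P(ξ,·) · S = 0`, either
`μ = 1` or the coefficient `a - (r / N) (a / (N - 1) + b)` vanishes. -/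
theorem IsSasakian.mul_one_sub_eq_zero [T2Space M] (hA : A.IsSasakian)
    (hE : 1 < Module.finrank ℝ E) {lam mu : ℝ} {p : M → ℝ}
    (hsol : A.IsStarConformalEtaRicciSoliton lam mu p) {a b : ℝ}
    (hP : ∀ u v w : TangentSpace I x,
      derivationAction (pseudoProjective a b x (A.xi x) u) (ricci x) v w = 0) :
    (a - scalarCurvature I x / Module.finrank ℝ E * (a / (Module.finrank ℝ E - 1) + b))
      * (1 - mu) = 0 := by
  obtain ⟨v, hv, hη⟩ := A.exists_unit_eta_eq_zero hE x
  have h1 := hA.mul_ricci_sub_eq_zero hP hv hη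
  have h2 := hA.mul_ricci_sub_eq_zero hP (v := A.phi x v)
    (by rw [A.inner_phi_phi, hη, hv]; ring) (A.eta_phi x v)
  have h3 := hsol.ricci_add_ricci hA hv hη
  rw [← eq_sub_iff_add_eq'] at h3
  rw [h3] at h2
  linarith

end AlmostContactMetric

end SasakiGeom

theorem theorem4p5 {E : Type*} [NormedAddCommGroup E] [NormedSpace ℝ E] [FiniteDimensional ℝ E]
    {M : Type*} [TopologicalSpace M] [T2Space M] [SecondCountableTopology M] [Nonempty M]
    [ChartedSpace E M] [IsManifold 𝓘(ℝ, E) ∞ M]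
    [RiemannianBundle (fun x : M ↦ TangentSpace 𝓘(ℝ, E) x)]
    [IsContMDiffRiemannianBundle 𝓘(ℝ, E) ∞ E (fun x : M ↦ TangentSpace 𝓘(ℝ, E) x)]
    (n : ℕ) (hn : 1 ≤ n) (hdim : Module.finrank ℝ E = 2 * n + 1)
    (A : SasakiGeom.AlmostContactMetric 𝓘(ℝ, E) M) (hA : A.IsSasakian)
    (lam mu : ℝ) (p : M → ℝ) (hsol : A.IsStarConformalEtaRicciSoliton lam mu p)
    (a b : ℝ) (ha : a ≠ 0) (hb : b ≠ 0)
    (hP : ∀ (x : M) (u v w : TangentSpace 𝓘(ℝ, E) x),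
      SasakiGeom.derivationAction (SasakiGeom.pseudoProjective a b x (A.xi x) u)
        (SasakiGeom.ricci x) v w = 0) :
    ((mu = 1 ∧ ∀ x : M, lam = 1 / 2 * (p x + 2 / (2 * (n : ℝ) + 1)) - 1) ∨
      ∀ x : M, a - SasakiGeom.scalarCurvature 𝓘(ℝ, E) x / (2 * (n : ℝ) + 1)
        * (a / (2 * (n : ℝ)) + b) = 0) ∧
    ((∀ x : M, SasakiGeom.scalarCurvature 𝓘(ℝ, E) x = -1) →
      (mu = 1 ∧ ∀ x : M, lam = 1 / 2 * (p x + 2 / (2 * (n : ℝ) + 1)) - 1) ∨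
      (2 * (n : ℝ) * (2 * (n : ℝ) + 1) + 1) * a + 2 * (n : ℝ) * b = 0) := by
  have hN : (Module.finrank ℝ E : ℝ) = 2 * n + 1 := by rw [hdim]; push_cast; ring
  have key : (mu = 1 ∧ ∀ x : M, lam = 1 / 2 * (p x + 2 / (2 * (n : ℝ) + 1)) - 1) ∨
      ∀ x : M, a - SasakiGeom.scalarCurvature 𝓘(ℝ, E) x / (2 * (n : ℝ) + 1)
        * (a / (2 * (n : ℝ)) + b) = 0 := by
    by_cases hmu : mu = 1
    · refine Or.inl ⟨hmu, fun x ↦ ?_⟩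
      have h := hsol.xi_xi hA x
      rw [hN, hmu] at h
      linarith
    · refine Or.inr fun x ↦ ?_
      have h := hA.mul_one_sub_eq_zero (by omega) hsol (hP x)
      rw [hN, add_sub_cancel_right] at h
      exact (mul_eq_zero.mp h).resolve_right (sub_ne_zero.mpr (Ne.symm hmu))
  refine ⟨key, fun hr ↦ key.imp_right fun h ↦ ?_⟩
  obtain ⟨x⟩ := ‹Nonempty M›
  have hx := h x
  rw [hr x] at hx
  have hn0 : (n : ℝ) ≠ 0 := Nat.cast_ne_zero.mpr (by omega)
  have hn1 : 2 * (n : ℝ) + 1 ≠ 0 := by positivity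
  field_simp at hx
  linarith
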